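/- **Setting.** Let $\Phi$ be a finite, reduced, irreducible crystallographic root system with simple roots $\alpha_i$ ($i\in I$), positive roots $\Phi^+$, highest root $\theta$, Weyl group $W$ and coroot lattice $Q^\vee$. Let $W_{\mathrm{af}}=W\ltimes Q^\vee$ be the (untwisted) affine Weyl group, with translations $t_\mu$ ($\mu\in Q^\vee$). Its affine real roots are $\alpha+n\delta$ ($\alpha\in\Phi$, $n\in\mathbb Z$), with classical part $\alpha$; such a root is positive if $n>0$, or $n=0$ and $\alpha\in\Phi^+$, and negative if its negative is positive. The group acts by $wt_\mu(\alpha+n\delta)=w\alpha+(n-\langle\mu,\alpha\rangle)\delta$, and the reflections are $r_{\alpha+n\delta}=r_\alpha t_{n\alpha^\vee}$. The simple reflections are $r_{\alpha_i}$ ($i\in I$) and $r_{-\theta+\delta}$. Lengths $\ell$ are word lengths in the simple reflections; the Bruhat order on $W$ and on $W_{\mathrm{af}}$ is generated by $u<ur$ for reflections $r$ with $\ell(u)<\ell(ur)$, and $\lessdot$ denotes its covers. Let $J\subseteq I$ (equivalently, $J=\{i:\langle\alpha_i^\vee,\lambda\rangle=0\}$ for a dominant weight $\lambda$), $W_J=\langle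 r_{\alpha_j}: j\in J\rangle$, $\Phi_J$ the roots in the span of $\{\alpha_j\}_{j\in J}$, $\Phi_J^+=\Phi_J\cap\Phi^+$, $Q_J^\vee=\bigoplus_{j\in J}\mathbb Z\alpha_j^\vee$, $2\rho=\sum_{\beta\in\Phi^+}\beta$, $2\rho_J=\sum_{\beta\in\Phi_J^+}\beta$; let $W^J$ be the set of minimum-length representatives of $W/W_J$, and $\lfloor v\rfloor$ that of $vW_J$. The parabolic quantum Bruhat graph $\mathrm{QB}(W^J)$ has vertex set $W^J$ and, for $w\in W^J$ and $\alpha\in\Phi^+\setminus\Phi_J^+$, an edge $w\xrightarrow{\alpha}\lfloor wr_\alpha\rfloor$ of Bruhat type if $w\lessdot wr_\alpha$ and of quantum type if $\ell(\lfloor wr_\alpha\rfloor)=\ell(w)+1-\langle\alpha^\vee,2\rho-2\rho_J\rangle$; $\mathrm{QB}(W)$ is the case $J=\emptyset$. Let $(W_J)_{\mathrm{af}}=W_J\ltimes Q_J^\vee$, and let $(W^J)_{\mathrm{af}}$ be the set of $x\in W_{\mathrm{af}}$ with $x\beta>0$ for every positive affine root $\beta$ with classical part in $\Phi_J$. Every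 $x\in W_{\mathrm{af}}$ factors uniquely as $x=x_1x_2$ with $x_1\in(W^J)_{\mathrm{af}}$, $x_2\in(W_J)_{\mathrm{af}}$; put $\pi_J(x)=x_1$. Call $\mu\in Q^\vee$ *$J$-adjusted* if $\pi_J(t_\mu)=z_\mu t_\mu$ with $z_\mu\in W$, and *$J$-superantidominant to depth $k$* if $\langle\mu,\alpha\rangle\le 0$ for all $\alpha\in\Phi^+$ and $\langle\mu,\alpha\rangle\le -k$ for all $\alpha\in\Phi^+\setminus\Phi_J^+$. Let $\Omega_J^{k}$ be the set of elements $w\,\pi_J(t_\mu)$ with $w\in W^J$ and $\mu\in Q^\vee$ $J$-adjusted and $J$-superantidominant to depth $k$; such an element is said to lie over $w$. A cover $y\lessdot x$ in $\Omega_J^k$ is a Bruhat cover $y\lessdot x$ in $W_{\mathrm{af}}$ with $x,y\in\Omega_J^k$ and $y=xr_\gamma$ for some affine real root $\gamma$ with classical part in $\Phi\setminus\Phi_J$. **Proposition.** There are constants $k_0,c\in\mathbb N$, depending only on $\Phi$, such that for every $J\subseteq I$ the following holds. For every $k$ there is a $J$-adjusted $\mu\in Q^\vee$ that is $J$-superantidominant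 to depth $k$. Moreover, for every $k\ge k_0$: (1) Let $w\xrightarrow{\alpha}\lfloor wr_\alpha\rfloor$ be an edge of $\mathrm{QB}(W^J)$, let $\chi=0$ if it is of Bruhat type and $\chi=1$ if it is of quantum type, and let $\mu\in Q^\vee$ be $J$-adjusted, with $\pi_J(t_\mu)=zt_\mu$, and $J$-superantidominant to depth $k+c$. Then there is a cover $y\lessdot x$ in $\Omega_J^k$, with $x$ lying over $w$ and $y$ over $\lfloor wr_\alpha\rfloor$, where $$x=wzt_\mu,\qquad y=xr_{\widetilde\alpha}=wr_\alpha t_{\chi\alpha^\vee}zt_\mu,\qquad \widetilde\alpha=z^{-1}\alpha+(\chi+\langle\mu,z^{-1}\alpha\rangle)\delta,$$ and $\widetilde\alpha$ is a negative affine root. (2) Let $y\lessdot x$ be any cover in $\Omega_J^k$. Then we can write $x=wzt_\mu$ with $w\in W^J$, $z=z_\mu\in W_J$, $\mu\in Q^\vee$ $J$-adjusted and $J$-superantidominant to depth $k$, and $y=xr_\gamma$ with $\gamma=z^{-1}\alpha+n\delta$, $\alpha\in\Phi^+\setminus\Phi_J^+$, $n\in\mathbb Z$, such that, with $\chi:=n-\langle\mu,z^{-1}\alpha\rangle$: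 $\chi\in\{0,1\}$; $\gamma=z^{-1}\alpha+(\chi+\langle\mu,z^{-1}\alpha\rangle)\delta$ is a negative affine root; $x$ lies over $w$ and $y$ over $\lfloor wr_\alpha\rfloor$; there is an edge $wz\xrightarrow{z^{-1}\alpha}wr_\alpha z$ in $\mathrm{QB}(W)$ and an edge $w\xrightarrow{\alpha}\lfloor wr_\alpha\rfloor$ in $\mathrm{QB}(W^J)$; and both edges are of Bruhat type if $\chi=0$ and of quantum type if $\chi=1$. -/

import Mathlib

noncomputable section

namespace QBLift

/-! ### Length and Bruhat order of a group with generators and reflections -/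

section Bruhat

variable {G : Type*} [Group G]

/-- The length of `g` with respect to the generating set `S`: the least length of a word in `S`
with product `g`. -/
def wordLength (S : Set G) (g : G) : ℕ :=
  sInf {n | ∃ l : List G, (∀ s ∈ l, s ∈ S) ∧ l.prod = g ∧ l.length = n}

/-- The strict Bruhat order attached to simple reflections `S` and reflections `T`: it is generated
by the relations `u < u * t` for `t ∈ T` with `ℓ(u) < ℓ(u * t)`. -/
def BruhatLT (S T : Set G) : G → G → Prop :=
  Relation.TransGen fun u v => ∃ t ∈ T, v = u * t ∧ wordLength S u < wordLength S v

/-- `u ⋖ v`: the element `v` covers `u` in the Bruhat order. -/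
def BruhatCover (S T : Set G) (u v : G) : Prop :=
  BruhatLT S T u v ∧ ∀ x, BruhatLT S T u x → ¬ BruhatLT S T x v

end Bruhat

variable {ι M N : Type*} [AddCommGroup M] [Module ℝ M] [AddCommGroup N] [Module ℝ N]
  {P : RootPairing ι ℝ M N}

/-! ### The finite Weyl group and its parabolic quotients.
Roots are referred to by their index in `ι`, on which the Weyl group acts. -/

section Finite

/-- The reflection `r_α` in the finite Weyl group `W`. -/
abbrev refl (P : RootPairing ι ℝ M N) (α : ι) : P.weylGroup :=
  RootPairing.weylGroup.ofIdx P α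

/-- The simple reflections `r_i`, `i ∈ I`. -/
def simpleRefls (b : P.Base) : Set P.weylGroup := refl P '' b.support

/-- The length function on `W`. -/
def len (b : P.Base) (w : P.weylGroup) : ℕ := wordLength (simpleRefls b) w

/-- The Bruhat cover `u ⋖ v` in `W`. -/
def Cover (b : P.Base) (u v : P.weylGroup) : Prop :=
  BruhatCover (simpleRefls b) (Set.range (refl P)) u v

/-- The parabolic subgroup `W_J`. -/
def parabolic (P : RootPairing ι ℝ M N) (J : Finset ι) : Subgroup P.weylGroup :=
  Subgroup.closure (refl P '' J)

/-- The (indices of the) roots in `Φ_J`: those in the lattice spanned by the `α_j`, `j ∈ J`. -/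
def rootsJ (P : RootPairing ι ℝ M N) (J : Finset ι) : Set ι :=
  {α | P.root α ∈ Submodule.span ℤ (P.root '' J)}

/-- The set `W^J` of minimum-length representatives of the cosets in `W / W_J`. -/
def minReps (b : P.Base) (J : Finset ι) : Set P.weylGroup :=
  {w | ∀ u ∈ parabolic P J, len b w ≤ len b (w * u)}

theorem exists_minRep (b : P.Base) (J : Finset ι) (v : P.weylGroup) :
    ∃ w ∈ minReps b J, v⁻¹ * w ∈ parabolic P J := by
  have hne : {n | ∃ w, v⁻¹ * w ∈ parabolic P J ∧ len b w = n}.Nonempty :=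
    ⟨_, v, by simp [one_mem], rfl⟩
  obtain ⟨w, hw, hn⟩ := Nat.sInf_mem hne
  refine ⟨w, fun u hu => ?_, hw⟩
  rw [hn]
  exact Nat.sInf_le ⟨w * u, by simpa [mul_assoc] using mul_mem hw hu, rfl⟩

/-- `⌊v⌋`: the minimum-length representative of the coset `v W_J`. -/
def floor (b : P.Base) (J : Finset ι) (v : P.weylGroup) : P.weylGroup :=
  (exists_minRep b J v).choose

end Finite

/-! ### The parabolic quantum Bruhat graph -/

section QB

variable [Fintype ι] [P.IsCrystallographic]

open Classical in
/-- The integer `⟨α^∨, 2ρ - 2ρ_J⟩`. -/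
def rhoPairing (b : P.Base) (J : Finset ι) (α : ι) : ℤ :=
  (∑ β : ι with b.IsPos β, P.pairingIn ℤ β α) -
    ∑ β : ι with b.IsPos β ∧ β ∈ rootsJ P J, P.pairingIn ℤ β α

/-- There is an edge of Bruhat type in `QB(W^J)` from `w` to `v` with label `α`. -/
def IsBruhatEdge (b : P.Base) (J : Finset ι) (w : P.weylGroup) (α : ι) (v : P.weylGroup) : Prop :=
  w ∈ minReps b J ∧ b.IsPos α ∧ α ∉ rootsJ P J ∧ v = floor b J (w * refl P α) ∧
    Cover b w (w * refl P α)

/-- There is an edge of quantum type in `QB(W^J)` from `w` to `v` with label `α`. -/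
def IsQuantumEdge (b : P.Base) (J : Finset ι) (w : P.weylGroup) (α : ι) (v : P.weylGroup) : Prop :=
  w ∈ minReps b J ∧ b.IsPos α ∧ α ∉ rootsJ P J ∧ v = floor b J (w * refl P α) ∧
    (len b v : ℤ) = len b w + 1 - rhoPairing b J α

/-- There is an edge in `QB(W^J)` from `w` to `v` with label `α`, which is of Bruhat type and
`χ = 0`, or of quantum type and `χ = 1`. For `J = ∅` the graph is `QB(W)`. -/
def IsEdge (b : P.Base) (J : Finset ι) (χ : ℤ) (w : P.weylGroup) (α : ι) (v : P.weylGroup) : Prop :=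
  (χ = 0 ∧ IsBruhatEdge b J w α v) ∨ (χ = 1 ∧ IsQuantumEdge b J w α v)

end QB

/-! ### The affine Weyl group -/

section Affine

/-- The action of an element of `W` on the ambient space `N` of the coroots. (In Mathlib the coweight
map of an automorphism acts contravariantly, hence the inverse.) -/
def corootMap (w : P.weylGroup) : N →+ N :=
  (RootPairing.Equiv.coweightEquiv P P (w⁻¹ : P.weylGroup).1).toLinearMap.toAddMonoidHom

theorem corootMap_one (x : N) : corootMap (1 : P.weylGroup) x = x := by
  simp only [corootMap, inv_one, OneMemClass.coe_one]
  rfl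

theorem corootMap_mul (v w : P.weylGroup) (x : N) :
    corootMap (v * w) x = corootMap v (corootMap w x) := by
  simp only [corootMap, mul_inv_rev, Subgroup.coe_mul]
  rfl

theorem corootMap_coroot (w : P.weylGroup) (i : ι) :
    corootMap w (P.coroot i) = P.coroot (w • i) := by
  have h := RootPairing.Hom.coroot_coweightMap_apply P P i ((w⁻¹ : P.weylGroup).1).toHom
  refine Eq.trans h ?_
  rw [Subgroup.coe_inv, RootPairing.Equiv.indexEquiv_inv]
  rfl

theorem corootMap_mem (w : P.weylGroup) {x : N} (hx : x ∈ P.corootSpan ℤ) :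
    corootMap w x ∈ P.corootSpan ℤ := by
  induction hx using Submodule.span_induction with
  | mem x hx =>
    obtain ⟨i, rfl⟩ := hx
    rw [corootMap_coroot]
    exact Submodule.subset_span ⟨_, rfl⟩
  | zero => simp
  | add x y _ _ hx hy => rw [map_add]; exact add_mem hx hy
  | smul a x _ hx => rw [map_zsmul]; exact Submodule.smul_mem _ a hx

/-- The automorphism of the coroot lattice `Q^∨` given by an element of `W`. -/
def latticeEquiv (w : P.weylGroup) : P.corootSpan ℤ ≃+ P.corootSpan ℤ where
  toFun μ := ⟨corootMap w (μ : N), corootMap_mem w μ.2⟩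
  invFun μ := ⟨corootMap w⁻¹ (μ : N), corootMap_mem w⁻¹ μ.2⟩
  left_inv μ := by ext; simp [← corootMap_mul, corootMap_one]
  right_inv μ := by ext; simp [← corootMap_mul, corootMap_one]
  map_add' μ ν := by ext; simp

/-- The action of `W` on the coroot lattice `Q^∨`, the latter written multiplicatively. -/
def latticeAct (P : RootPairing ι ℝ M N) :
    P.weylGroup →* MulAut (Multiplicative (P.corootSpan ℤ)) where
  toFun w := (latticeEquiv w).toMultiplicative
  map_one' := by
    ext μ
    exact corootMap_one _
  map_mul' v w := by
    ext μ
    exact corootMap_mul v w _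

/-- The affine Weyl group `W_af = Q^∨ ⋊ W`. -/
abbrev AffWeyl (P : RootPairing ι ℝ M N) : Type _ :=
  Multiplicative (P.corootSpan ℤ) ⋊[latticeAct P] P.weylGroup

/-- The translation `t_μ`, for `μ ∈ Q^∨`. -/
abbrev transl (μ : P.corootSpan ℤ) : AffWeyl P :=
  SemidirectProduct.inl (Multiplicative.ofAdd μ)

/-- The inclusion of `W` in `W_af`. -/
abbrev fin (w : P.weylGroup) : AffWeyl P := SemidirectProduct.inr w

/-- A pair `(α, n)` is the affine real root `α + n δ`; here `α` is its classical part. -/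
abbrev AffRoot (_ : RootPairing ι ℝ M N) : Type _ := ι × ℤ

/-- The reflection in `α + n δ`, which is `r_α t_{n α^∨}`. -/
def affRefl (γ : AffRoot P) : AffWeyl P :=
  fin (refl P γ.1) * transl (γ.2 • P.corootSpanMem ℤ γ.1)

/-- The positive affine real roots. -/
def AffPos (b : P.Base) (γ : AffRoot P) : Prop := 0 < γ.2 ∨ (γ.2 = 0 ∧ b.IsPos γ.1)

/-- The negative affine real roots: those `γ` with `-γ` positive. -/
def AffNeg (b : P.Base) (γ : AffRoot P) : Prop := AffPos b (P.reflectionPerm γ.1 γ.1, -γ.2)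

/-- The root `θ` is the highest root. -/
def IsHighestRoot (b : P.Base) (θ : ι) : Prop :=
  ∀ i, P.root θ - P.root i ∈ AddSubmonoid.closure (P.root '' b.support)

/-- The simple reflections of `W_af`: the reflections in the simple roots `α_i`, `i ∈ I`, and in
`α_0 = -θ + δ`, where `θ` is the highest root. -/
def affSimpleRefls (b : P.Base) : Set (AffWeyl P) :=
  {s | (∃ i ∈ b.support, s = affRefl (i, 0)) ∨
    ∃ θ, IsHighestRoot b θ ∧ s = affRefl (P.reflectionPerm θ θ, 1)}

/-- The Bruhat cover `u ⋖ v` in `W_af`. -/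
def AffCover (b : P.Base) (u v : AffWeyl P) : Prop :=
  BruhatCover (affSimpleRefls b) (Set.range affRefl) u v

/-- The subgroup `(W_J)_af`, as the set of all `u t_ν` with `u ∈ W_J` and `ν ∈ Q_J^∨`. -/
def affParabolic (P : RootPairing ι ℝ M N) (J : Finset ι) : Set (AffWeyl P) :=
  {x | ∃ u ∈ parabolic P J, ∃ ν : P.corootSpan ℤ,
    (ν : N) ∈ Submodule.span ℤ (P.coroot '' J) ∧ x = fin u * transl ν}

variable [P.IsCrystallographic]

/-- The pairing `⟨μ, α⟩` of an element of the coroot lattice with a root. -/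
abbrev pair (μ : P.corootSpan ℤ) (α : ι) : ℤ := P.root'In ℤ α μ

/-- The action of `W_af` on affine real roots: `w (α + n δ) = wα + n δ` for `w ∈ W` and
`t_ν (α + n δ) = α + (n - ⟨ν, α⟩) δ`. -/
def affAct (x : AffWeyl P) (γ : AffRoot P) : AffRoot P :=
  (x.right • γ.1, γ.2 - pair (Multiplicative.toAdd x.left) (x.right • γ.1))

/-- The set `(W^J)_af` of all `x` with `x β > 0` for each positive affine root `β` with classical
part in `Φ_J`. -/
def affMinReps (b : P.Base) (J : Finset ι) : Set (AffWeyl P) :=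
  {x | ∀ β : AffRoot P, AffPos b β → β.1 ∈ rootsJ P J → AffPos b (affAct x β)}

/-- `p = π_J(x)`: the graph of the map `π_J : W_af → (W^J)_af`, which sends `x` to the factor in
`(W^J)_af` of its unique factorization as an element of `(W^J)_af` times one of `(W_J)_af`. -/
def IsProj (b : P.Base) (J : Finset ι) (x p : AffWeyl P) : Prop :=
  p ∈ affMinReps b J ∧ ∃ u ∈ affParabolic P J, x = p * u

/-- `μ` is `J`-adjusted: `π_J(t_μ) = z t_μ` for some `z ∈ W`. -/
def IsAdjusted (b : P.Base) (J : Finset ι) (μ : P.corootSpan ℤ) : Prop :=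
  ∃ z : P.weylGroup, IsProj b J (transl μ) (fin z * transl μ)

/-- `μ` is `J`-superantidominant to depth `k`: it is antidominant and `⟨μ, α⟩ ≤ -k` for all `α` in
`Φ⁺ \ Φ_J⁺`. -/
def IsSuperantidominant (b : P.Base) (J : Finset ι) (k : ℕ) (μ : P.corootSpan ℤ) : Prop :=
  (∀ α, b.IsPos α → pair μ α ≤ 0) ∧ ∀ α, b.IsPos α → α ∉ rootsJ P J → pair μ α ≤ -(k : ℤ)

/-- `x` is an element of `Ω_J^∞` (with superantidominance to depth `k`) over the vertex `w` of
`QB(W^J)`: that is, `x = w π_J(t_μ)` with `w ∈ W^J` and `μ` `J`-superantidominant and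
`J`-adjusted. -/
def LiesOver (b : P.Base) (J : Finset ι) (k : ℕ) (x : AffWeyl P) (w : P.weylGroup) : Prop :=
  w ∈ minReps b J ∧ ∃ μ, IsSuperantidominant b J k μ ∧ IsAdjusted b J μ ∧
    ∃ p, IsProj b J (transl μ) p ∧ x = fin w * p

/-- The set `Ω_J^∞`, with superantidominance to depth `k`. -/
def Omega (b : P.Base) (J : Finset ι) (k : ℕ) : Set (AffWeyl P) := {x | ∃ w, LiesOver b J k x w}

/-- The covers `y ⋖ x` in `Ω_J^∞`: Bruhat covers in `W_af` whose connecting root has classical part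
in `Φ \ Φ_J`. -/
def OmegaCover (b : P.Base) (J : Finset ι) (k : ℕ) (y x : AffWeyl P) : Prop :=
  y ∈ Omega b J k ∧ x ∈ Omega b J k ∧ AffCover b y x ∧
    ∃ γ : AffRoot P, γ.1 ∉ rootsJ P J ∧ y = x * affRefl γ

end Affine

end QBLift

end

noncomputable section

set_option linter.unusedSectionVars false

namespace QBLift

/-! ### Groups acting on a set of roots -/

section WordLength

variable {G : Type*} [Group G] {S : Set G}

/-! Everything reduces to counting lengths. For `x` in the affine Weyl group, `shift b x α` measures
how far `x` moves the point where the string `α + ℤδ` turns positive, and the length of `x` is the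
sum of `|shift b x α|` over the positive roots `α`. If `x = w z t_μ` lies in `Ω_J`, these shifts
vanish on `Φ_J` and are nonpositive at the positive roots outside `Φ_J`. Since `W_J` permutes the
latter, `ℓ(x) = -∑ ⟨μ, α⟩ - ℓ(w)`, summed over `Φ⁺ \ Φ_J⁺` (`inversions_eq`). Let `y = x r_γ` be a
second element of `Ω_J`, over `v`, with `γ = z⁻¹α + (χ + ⟨μ, z⁻¹α⟩)δ`. Its translation part is `μ +
χ z⁻¹α^∨`, so `ℓ(x) - ℓ(y) = ℓ(v) - ℓ(w) + χ⟨α^∨, 2ρ - 2ρ_J⟩` (`inversions_sub`). That this equals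
one is the length condition of an edge, of Bruhat type for `χ = 0` and of quantum type for `χ = 1`.

From covers to edges, the strict estimate `|ℓ(w) - ℓ(v)| < ⟨α^∨, 2ρ - 2ρ_J⟩`
(`abs_len_sub_len_floor_lt`) forces `χ ∈ {0, 1}`. The edge in `QB(W)` then follows from `ℓ(wz) =
ℓ(w) + ℓ(z)` and `ℓ(z) = -∑ ⟨μ, δ⟩` over `δ ∈ Φ_J⁺`.

From edges to covers, the issue is that `μ + χ z⁻¹α^∨` must again be `J`-adjusted. This amounts to
`χ⟨α^∨, β⟩ = [β < 0] - [w r_α β < 0]` for `β ∈ Φ_J` (`IsEdge.mul_pairingIn`). For a Bruhat edge both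
sides vanish because `w r_α ∈ W^J`; for a quantum edge the length estimate above is as sharp as it
can be, which determines every term in it (`pairingIn_of_quantum`).

Two foundations are needed. The abstract `ReflectionSystem` gives strong exchange, the length
formula, and the description of Bruhat covers as reflections that change the length by one; it
serves both `W` and `W_af`. The lemma `eq_zero_of_pair_le_one` says that a nonzero vector of a
coroot lattice pairs to at least two with some root. It yields generation of `W_af` by simple
reflections and uniqueness of `π_J(t_μ)`. -/

theorem wordLength_le_length {l : List G} (hl : ∀ s ∈ l, s ∈ S) :
    wordLength S l.prod ≤ l.length :=
  Nat.sInf_le ⟨l, hl, rfl, rfl⟩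

theorem exists_reduced_word (hinv : ∀ s ∈ S, s⁻¹ = s) (hS : Subgroup.closure S = ⊤) (g : G) :
    ∃ l : List G, (∀ s ∈ l, s ∈ S) ∧ l.prod = g ∧ l.length = wordLength S g := by
  have hne : {n | ∃ l : List G, (∀ s ∈ l, s ∈ S) ∧ l.prod = g ∧ l.length = n}.Nonempty := by
    have hg : g ∈ Subgroup.closure S := hS ▸ Subgroup.mem_top g
    rw [← Subgroup.mem_toSubmonoid, Subgroup.closure_toSubmonoid] at hg
    obtain ⟨l, hl, rfl⟩ := Submonoid.exists_list_of_mem_closure hg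
    refine ⟨_, l, fun s hs => ?_, rfl, rfl⟩
    rcases hl s hs with h | h
    · exact h
    · have := hinv _ h
      rw [inv_inv] at this
      rwa [this]
  exact Nat.sInf_mem hne

theorem wordLength_one : wordLength S (1 : G) = 0 := by
  simpa using wordLength_le_length (S := S) (l := []) (by simp)

end WordLength

/-- A group acting on a set of roots with a choice of positive roots, such that the reflections in
the roots of `Δ` generate the group and each of them makes a single positive root negative. The
function `L` grows by one under right multiplication by a simple reflection whose root is sent to a
positive root. -/
structure ReflectionSystem (G R : Type*) [Group G] [MulAction G R] where
  pos : R → Prop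
  neg : R → R
  refl : R → G
  Δ : Set R
  L : G → ℕ
  refl_smul : ∀ (g : G) β, refl (g • β) = g * refl β * g⁻¹
  refl_mul_self : ∀ β, refl β * refl β = 1
  refl_neg : ∀ β, refl (neg β) = refl β
  pos_neg : ∀ β, pos (neg β) ↔ ¬ pos β
  smul_neg : ∀ (g : G) β, g • neg β = neg (g • β)
  refl_smul_self : ∀ β, refl β • β = neg β
  pos_of_mem : ∀ a ∈ Δ, pos a
  eq_of_not_pos : ∀ a ∈ Δ, ∀ β, pos β → ¬ pos (refl a • β) → β = a
  closure_eq_top : Subgroup.closure (refl '' Δ) = ⊤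
  L_one : L 1 = 0
  L_mul : ∀ a ∈ Δ, ∀ g, pos (g • a) → L (g * refl a) = L g + 1

namespace ReflectionSystem

variable {G R : Type*} [Group G] [MulAction G R] (D : ReflectionSystem G R)

/-- The word length in the simple reflections. -/
abbrev wl (g : G) : ℕ := wordLength (D.refl '' D.Δ) g

/-- The strict Bruhat order. -/
abbrev lt (u v : G) : Prop := BruhatLT (D.refl '' D.Δ) (Set.range D.refl) u v

theorem inv_refl (β : R) : (D.refl β)⁻¹ = D.refl β :=
  inv_eq_of_mul_eq_one_left (D.refl_mul_self β)

theorem inv_eq_of_mem : ∀ s ∈ D.refl '' D.Δ, s⁻¹ = s := by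
  rintro _ ⟨a, -, rfl⟩
  exact D.inv_refl a

theorem exists_word (g : G) :
    ∃ l : List G, (∀ s ∈ l, s ∈ D.refl '' D.Δ) ∧ l.prod = g ∧ l.length = D.wl g :=
  exists_reduced_word D.inv_eq_of_mem D.closure_eq_top g

theorem mul_refl_mul_refl (g : G) (β : R) : g * D.refl β * D.refl β = g := by
  rw [mul_assoc, D.refl_mul_self, mul_one]

theorem mul_refl (g : G) (β : R) : g * D.refl β = D.refl (g • β) * g := by
  rw [D.refl_smul]; group

theorem refl_mul (g : G) (β : R) : D.refl β * g = g * D.refl (g⁻¹ • β) := by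
  rw [D.mul_refl, smul_inv_smul]

theorem wl_one : D.wl 1 = 0 := wordLength_one

theorem wl_mul_le {a : R} (ha : a ∈ D.Δ) (g : G) : D.wl (g * D.refl a) ≤ D.wl g + 1 := by
  obtain ⟨l, hl, rfl, hlen⟩ := D.exists_word g
  rw [← hlen]
  have h := wordLength_le_length (S := D.refl '' D.Δ) (l := l ++ [D.refl a]) (by
    intro s hs
    rcases List.mem_append.1 hs with h | h
    · exact hl s h
    · rw [List.mem_singleton.1 h]; exact ⟨a, ha, rfl⟩)
  simpa using h

theorem mul_wl_le {a : R} (ha : a ∈ D.Δ) (g : G) : D.wl (D.refl a * g) ≤ D.wl g + 1 := by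
  obtain ⟨l, hl, rfl, hlen⟩ := D.exists_word g
  rw [← hlen]
  have h := wordLength_le_length (S := D.refl '' D.Δ) (l := D.refl a :: l) (by
    intro s hs
    rcases List.mem_cons.1 hs with h | h
    · rw [h]; exact ⟨a, ha, rfl⟩
    · exact hl s h)
  simpa using h

/-- The strong exchange property. -/
theorem exchange (l : List G) (hl : ∀ s ∈ l, s ∈ D.refl '' D.Δ) (β : R) (hβ : D.pos β)
    (hneg : ¬ D.pos (l.prod • β)) :
    ∃ l' : List G, (∀ s ∈ l', s ∈ D.refl '' D.Δ) ∧ l'.prod = l.prod * D.refl β ∧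
      l'.length < l.length := by
  induction l using List.reverseRecOn generalizing β with
  | nil => simp [hβ] at hneg
  | append_singleton l s ih =>
    obtain ⟨a, ha, rfl⟩ := hl s (by simp)
    have hl' : ∀ s ∈ l, s ∈ D.refl '' D.Δ := fun s hs => hl s (by simp [hs])
    rw [List.prod_append, List.prod_singleton] at hneg ⊢
    by_cases h : D.pos (D.refl a • β)
    · obtain ⟨l', h1, h2, h3⟩ := ih hl' _ h (by rwa [smul_smul])
      refine ⟨l' ++ [D.refl a], ?_, ?_, by simpa using h3⟩
      · intro s hs
        rcases List.mem_append.1 hs with h | h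
        · exact h1 s h
        · rw [List.mem_singleton.1 h]; exact ⟨a, ha, rfl⟩
      · rw [List.prod_append, List.prod_singleton, h2, mul_assoc, mul_assoc, D.mul_refl _ β]
    · obtain rfl := D.eq_of_not_pos a ha β hβ h
      exact ⟨l, hl', (D.mul_refl_mul_refl _ _).symm, by simp⟩

theorem wl_mul_refl_lt {g : G} {β : R} (hβ : D.pos β) (hg : ¬ D.pos (g • β)) :
    D.wl (g * D.refl β) < D.wl g := by
  obtain ⟨l, hl, rfl, hlen⟩ := D.exists_word g
  obtain ⟨l', h1, h2, h3⟩ := D.exchange l hl β hβ hg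
  rw [← hlen, ← h2]
  exact (wordLength_le_length h1).trans_lt h3

theorem lt_wl_mul_refl {g : G} {β : R} (hβ : D.pos β) (hg : D.pos (g • β)) :
    D.wl g < D.wl (g * D.refl β) := by
  have h := D.wl_mul_refl_lt (g := g * D.refl β) hβ (by
    rw [mul_smul, D.refl_smul_self, D.smul_neg, D.pos_neg, not_not]; exact hg)
  rwa [D.mul_refl_mul_refl] at h

/-- The last letter of a reduced word sends its simple root to a positive root when applied after
the preceding letters are split off; otherwise strong exchange would shorten the word. Hence `L_mul`
adds one for each letter. -/
theorem wl_eq_L (g : G) : D.wl g = D.L g := by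
  induction hn : D.wl g generalizing g with
  | zero =>
    obtain ⟨l, hl, rfl, hlen⟩ := D.exists_word g
    rw [hn, List.length_eq_zero_iff] at hlen
    simp [hlen, D.L_one]
  | succ n ih =>
    obtain ⟨l, hl, rfl, hlen⟩ := D.exists_word g
    rcases List.eq_nil_or_concat' l with rfl | ⟨l', s, rfl⟩
    · rw [List.prod_nil, D.wl_one] at hn
      omega
    obtain ⟨a, ha, rfl⟩ := hl s (by simp)
    have hl' : ∀ s ∈ l', s ∈ D.refl '' D.Δ := fun s hs => hl s (by simp [hs])
    simp only [List.prod_append, List.prod_singleton, List.length_append,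
      List.length_singleton] at hlen hn ⊢
    have h1 := wordLength_le_length hl'
    have h2 := D.wl_mul_le ha l'.prod
    have h3 : D.wl l'.prod = n := by
      have : D.wl l'.prod ≤ l'.length := h1
      omega
    have h4 : D.pos (l'.prod • a) := by
      by_contra h
      have := D.wl_mul_refl_lt (D.pos_of_mem a ha) h
      omega
    rw [D.L_mul a ha _ h4, ← ih _ h3]

theorem eq_one_of_L_eq_zero {g : G} (hg : D.L g = 0) : g = 1 := by
  obtain ⟨l, -, rfl, hlen⟩ := D.exists_word g
  rw [D.wl_eq_L, hg, List.length_eq_zero_iff] at hlen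
  simp [hlen]

/-! ### Bruhat order: lifting property and covers. -/

theorem exists_pos_refl_eq (β : R) : ∃ β', D.pos β' ∧ D.refl β' = D.refl β := by
  by_cases h : D.pos β
  · exact ⟨β, h, rfl⟩
  · exact ⟨D.neg β, (D.pos_neg β).2 h, D.refl_neg β⟩

theorem pos_of_wl_lt {g : G} {β : R} (hβ : D.pos β) (h : D.wl g < D.wl (g * D.refl β)) :
    D.pos (g • β) := by
  by_contra h'
  have := D.wl_mul_refl_lt hβ h'
  omega

theorem lt_mul_refl {u : G} {β : R} (h : D.wl u < D.wl (u * D.refl β)) :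
    D.lt u (u * D.refl β) :=
  Relation.TransGen.single ⟨_, ⟨β, rfl⟩, rfl, h⟩

theorem wl_lt_of_lt {u v : G} (h : D.lt u v) : D.wl u < D.wl v := by
  induction h with
  | single h => obtain ⟨_, _, _, h⟩ := h; exact h
  | tail _ h ih => obtain ⟨_, _, _, h⟩ := h; exact ih.trans h

theorem lt_or_lt_refl_mul {a : R} (u : G) :
    D.lt u (D.refl a * u) ∨ D.lt (D.refl a * u) u := by
  rw [D.refl_mul]
  obtain ⟨β, hβ, h⟩ := D.exists_pos_refl_eq (u⁻¹ • a)
  rw [← h]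
  by_cases hu : D.pos (u • β)
  · exact Or.inl (D.lt_mul_refl (D.lt_wl_mul_refl hβ hu))
  · right
    have := D.lt_mul_refl (u := u * D.refl β) (β := β)
    rw [D.mul_refl_mul_refl] at this
    exact this (D.wl_mul_refl_lt hβ hu)

/-- Left multiplication by `r_a` reverses the relation only if the positive root `u β` becomes
negative, that is `u β = a`, and then `u r_β = r_a u`. -/
theorem refl_mul_eq_or_lt {a : R} (ha : a ∈ D.Δ) {u v : G} {β : R} (hv : v = u * D.refl β)
    (h : D.wl u < D.wl v) :
    D.refl a * u = v ∨ D.lt (D.refl a * u) (D.refl a * v) := by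
  subst hv
  obtain ⟨β', hβ', e⟩ := D.exists_pos_refl_eq β
  rw [← e] at h ⊢
  have hpos := D.pos_of_wl_lt hβ' h
  by_cases hs : D.pos (D.refl a • u • β')
  · right
    rw [← mul_assoc]
    exact D.lt_mul_refl (D.lt_wl_mul_refl hβ' (by rwa [mul_smul]))
  · left
    rw [D.mul_refl, D.eq_of_not_pos a ha _ hpos hs]

/-- The lifting property. -/
theorem lifting {a : R} (ha : a ∈ D.Δ) {u v : G} (h : D.lt u v) :
    D.refl a * u = v ∨ D.lt (D.refl a * u) v ∨ D.lt (D.refl a * u) (D.refl a * v) := by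
  induction h with
  | single h =>
    obtain ⟨_, ⟨β, rfl⟩, h1, h2⟩ := h
    rcases D.refl_mul_eq_or_lt ha h1 h2 with h | h
    · exact Or.inl h
    · exact Or.inr (Or.inr h)
  | tail _ h ih =>
    have hlt : D.lt _ _ := Relation.TransGen.single h
    obtain ⟨_, ⟨β, rfl⟩, h1, h2⟩ := h
    rcases ih with ih | ih | ih
    · rw [ih]; exact Or.inr (Or.inl hlt)
    · exact Or.inr (Or.inl (ih.trans hlt))
    · rcases D.refl_mul_eq_or_lt ha h1 h2 with h | h
      · rw [h] at ih; exact Or.inr (Or.inl ih)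
      · exact Or.inr (Or.inr (ih.trans h))

theorem exists_refl_mul_lt {v : G} (hv : D.wl v ≠ 0) : ∃ a ∈ D.Δ, D.wl (D.refl a * v) < D.wl v := by
  obtain ⟨l, hl, rfl, hlen⟩ := D.exists_word v
  cases l with
  | nil => rw [List.prod_nil, D.wl_one] at hv; omega
  | cons s l =>
    obtain ⟨a, ha, rfl⟩ := hl s (by simp)
    refine ⟨a, ha, ?_⟩
    rw [← hlen, List.prod_cons, ← mul_assoc, D.refl_mul_self, one_mul]
    exact (wordLength_le_length fun s hs => hl s (by simp [hs])).trans_lt (by simp)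

/-- Induction on the length of `v`, through a simple root `a` with `r_a v < v`. If `u < r_a u`, then
`r_a u` lies between. Otherwise induction gives `x` between `r_a u` and `r_a v`, and the lifting
property shows that `r_a v` or `r_a x` lies between `u` and `v`. -/
theorem exists_between {u v : G} {β : R} (hv : v = u * D.refl β) (h : D.wl u + 1 < D.wl v) :
    ∃ x, D.lt u x ∧ D.lt x v := by
  induction hn : D.wl v using Nat.strong_induction_on generalizing u v with
  | _ n ih =>
    obtain ⟨a, ha, hav⟩ := D.exists_refl_mul_lt (v := v) (by omega)
    have hav' : D.lt (D.refl a * v) v := by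
      rcases D.lt_or_lt_refl_mul (a := a) v with h' | h'
      · have := D.wl_lt_of_lt h'; omega
      · exact h'
    rcases D.lt_or_lt_refl_mul (a := a) u with hu | hu
    · refine ⟨D.refl a * u, hu, ?_⟩
      rcases D.refl_mul_eq_or_lt ha hv (by omega) with h' | h'
      · have := D.mul_wl_le ha u
        rw [h'] at this; omega
      · exact h'.trans hav'
    · have h1 : D.wl v ≤ D.wl (D.refl a * v) + 1 := by
        have := D.mul_wl_le ha (D.refl a * v)
        rwa [← mul_assoc, D.refl_mul_self, one_mul] at this
      have h2 := D.wl_lt_of_lt hu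
      obtain ⟨x, hx1, hx2⟩ := ih _ (by omega) (u := D.refl a * u) (v := D.refl a * v)
        (by rw [hv, mul_assoc]) (by omega) rfl
      have hxv : D.lt (D.refl a * x) v := by
        rcases D.lifting ha hx2 with h' | h' | h'
        · rw [h']; exact hav'
        · exact h'.trans hav'
        · rwa [← mul_assoc, D.refl_mul_self, one_mul] at h'
      rcases D.lifting ha hx1 with h' | h' | h' <;>
        rw [← mul_assoc, D.refl_mul_self, one_mul] at h'
      · exact ⟨_, h' ▸ hx2, hav'⟩
      · exact ⟨_, h'.trans hx2, hav'⟩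
      · exact ⟨_, h', hxv⟩

theorem cover_iff {u v : G} :
    BruhatCover (D.refl '' D.Δ) (Set.range D.refl) u v ↔
      ∃ β, v = u * D.refl β ∧ D.wl v = D.wl u + 1 := by
  constructor
  · rintro ⟨h, hmin⟩
    cases h with
    | single h =>
      obtain ⟨_, ⟨β, rfl⟩, h1, h2⟩ := h
      refine ⟨β, h1, ?_⟩
      by_contra hne
      change D.wl u < D.wl v at h2
      obtain ⟨x, hx1, hx2⟩ := D.exists_between h1 (by omega)
      exact hmin x hx1 hx2
    | tail h h' => exact absurd (Relation.TransGen.single h') (hmin _ h)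
  · rintro ⟨β, rfl, h⟩
    refine ⟨D.lt_mul_refl (by omega), fun x h1 h2 => ?_⟩
    have := D.wl_lt_of_lt h1
    have := D.wl_lt_of_lt h2
    omega

end ReflectionSystem

variable {ι M N : Type*} [AddCommGroup M] [Module ℝ M] [AddCommGroup N] [Module ℝ N]
  {P : RootPairing ι ℝ M N}

/-! ### The Weyl group acting on roots and coroots -/

section Weyl

theorem root_smul (w : P.weylGroup) (α : ι) : P.root (w • α) = w • P.root α :=
  RootPairing.Equiv.root_indexEquiv_eq_smul (P := P) α w.1

theorem refl_smul (α β : ι) : refl P α • β = P.reflectionPerm α β := rfl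

theorem refl_smul_vec (α : ι) (x : M) : refl P α • x = P.reflection α x := rfl

theorem weylGroup_ext {v w : P.weylGroup} (h : ∀ x : M, v • x = w • x) : v = w := by
  apply Subtype.ext
  apply RootPairing.Equiv.weightHom_injective P
  ext x
  exact h x

theorem toLinearMap_smul_corootMap (w : P.weylGroup) (x : M) (y : N) :
    P.toLinearMap (w • x) (corootMap w y) = P.toLinearMap x y := by
  have h := LinearMap.congr_fun (RootPairing.Hom.weight_coweight_transpose_apply P P
    (corootMap w y) w.1.toHom) x
  have h1 := corootMap_mul w⁻¹ w y
  rw [inv_mul_cancel, corootMap_one] at h1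
  have h2 : w.1.toHom.coweightMap (corootMap w y) = y := by
    refine Eq.trans ?_ h1.symm
    simp only [corootMap, inv_inv]
    rfl
  rw [h2] at h
  exact h

theorem smul_real (w : P.weylGroup) (c : ℝ) (x : M) : w • (c • x) = c • (w • x) :=
  smul_comm w.1 c x

theorem refl_conj (w : P.weylGroup) (α : ι) : refl P (w • α) = w * refl P α * w⁻¹ := by
  refine weylGroup_ext fun x => ?_
  rw [mul_smul, mul_smul, refl_smul_vec, refl_smul_vec, P.reflection_apply, P.reflection_apply,
    smul_sub, smul_inv_smul, root_smul, smul_real]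
  congr 2
  have h := toLinearMap_smul_corootMap w (w⁻¹ • x) (P.coroot α)
  rw [smul_inv_smul, corootMap_coroot] at h
  exact h

theorem refl_mul_self (α : ι) : refl P α * refl P α = 1 := by
  refine weylGroup_ext fun x => ?_
  rw [mul_smul, refl_smul_vec, refl_smul_vec, one_smul]
  simp

theorem refl_inv (α : ι) : (refl P α)⁻¹ = refl P α :=
  inv_eq_of_mul_eq_one_left (refl_mul_self α)

theorem refl_smul_refl_smul (α β : ι) : refl P α • refl P α • β = β := by
  rw [smul_smul, refl_mul_self, one_smul]

theorem root_reflectionPerm_self (α : ι) : P.root (P.reflectionPerm α α) = - P.root α := by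
  simp

theorem smul_reflectionPerm_self (w : P.weylGroup) (α : ι) :
    w • P.reflectionPerm α α = P.reflectionPerm (w • α) (w • α) := by
  apply P.root.injective
  rw [root_reflectionPerm_self, root_smul, root_reflectionPerm_self, root_smul, smul_neg]

theorem reflectionPerm_self_self (α : ι) :
    P.reflectionPerm (P.reflectionPerm α α) (P.reflectionPerm α α) = α := by
  apply P.root.injective
  rw [root_reflectionPerm_self, root_reflectionPerm_self, neg_neg]

theorem refl_reflectionPerm_self (α : ι) : refl P (P.reflectionPerm α α) = refl P α := by
  rw [← refl_smul, refl_conj, mul_assoc, mul_inv_cancel, mul_one]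

theorem weylGroup_closure [Finite ι] [P.IsCrystallographic] [P.IsReduced] (b : P.Base) :
    Subgroup.closure (simpleRefls b) = ⊤ := by
  have key : ∀ α, refl P α ∈ Subgroup.closure (simpleRefls b) := by
    intro α
    induction α using b.induction_reflect with
    | h₀ i hi => rwa [refl_reflectionPerm_self]
    | h₁ i hi => exact Subgroup.subset_closure ⟨i, hi, rfl⟩
    | h₂ i j hi hj =>
      have hj : refl P j ∈ Subgroup.closure (simpleRefls b) :=
        Subgroup.subset_closure ⟨j, hj, rfl⟩
      rw [← refl_smul, refl_conj]
      exact mul_mem (mul_mem hj hi) (inv_mem hj)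
  rw [eq_top_iff]
  rintro ⟨g, hg⟩ -
  induction hg using RootPairing.weylGroup.induction with
  | mem i => exact key i
  | one => exact one_mem _
  | mul x y hx hy h1 h2 => exact mul_mem h1 h2

theorem latticeEquiv_coroot (w : P.weylGroup) (α : ι) :
    latticeEquiv w (P.corootSpanMem ℤ α) = P.corootSpanMem ℤ (w • α) :=
  Subtype.ext (corootMap_coroot w α)

variable [P.IsCrystallographic]

theorem root_refl_smul (α β : ι) :
    P.root (refl P α • β) = P.root β - P.pairingIn ℤ β α • P.root α := by
  rw [root_smul, refl_smul_vec, P.reflection_apply_root' ℤ]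

theorem pair_cast (μ : P.corootSpan ℤ) (α : ι) :
    (pair μ α : ℝ) = P.toLinearMap (P.root α) (μ : N) :=
  P.algebraMap_root'In_apply ℤ α μ

theorem pair_latticeEquiv (w : P.weylGroup) (μ : P.corootSpan ℤ) (α : ι) :
    pair (latticeEquiv w μ) (w • α) = pair μ α := by
  have h : (pair (latticeEquiv w μ) (w • α) : ℝ) = pair μ α := by
    rw [pair_cast, pair_cast, root_smul]
    exact toLinearMap_smul_corootMap w _ _
  exact_mod_cast h

theorem pair_coroot (α β : ι) : pair (P.corootSpanMem ℤ α) β = P.pairingIn ℤ β α := rfl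

theorem pairingIn_smul (w : P.weylGroup) (α β : ι) :
    P.pairingIn ℤ (w • α) (w • β) = P.pairingIn ℤ α β := by
  rw [← pair_coroot, ← latticeEquiv_coroot, pair_latticeEquiv, pair_coroot]

theorem pair_neg_root (μ : P.corootSpan ℤ) (α : ι) :
    pair μ (P.reflectionPerm α α) = - pair μ α := by
  have h : (pair μ (P.reflectionPerm α α) : ℝ) = - pair μ α := by
    rw [pair_cast, pair_cast, root_reflectionPerm_self, map_neg, LinearMap.neg_apply]
  exact_mod_cast h

theorem latticeEquiv_refl (α : ι) (μ : P.corootSpan ℤ) :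
    latticeEquiv (refl P α) μ = μ - pair μ α • P.corootSpanMem ℤ α := by
  obtain ⟨x, hx⟩ := μ
  have hr : (pair (⟨x, hx⟩ : P.corootSpan ℤ) α : ℝ) • P.coroot α =
      pair (⟨x, hx⟩ : P.corootSpan ℤ) α • P.coroot α := Int.cast_smul_eq_zsmul ℝ _ _
  apply Subtype.ext
  change corootMap (refl P α) x = x - pair (⟨x, hx⟩ : P.corootSpan ℤ) α • P.coroot α
  rw [← hr, pair_cast]
  simp only [corootMap, refl_inv]
  exact P.coreflection_apply α x

end Weyl

/-! ### Positivity and coordinates -/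

section Positivity

variable (b : P.Base)

theorem isPos_neg_iff (α : ι) : b.IsPos (P.reflectionPerm α α) ↔ ¬ b.IsPos α :=
  RootPairing.Base.IsPos.neg_iff_not b α

theorem reflectionPerm_self_ne (α : ι) : P.reflectionPerm α α ≠ α := by
  intro h
  have h1 := root_reflectionPerm_self (P := P) α
  rw [h] at h1
  have h2 : (2 : ℝ) • P.root α = 0 := by
    rw [two_smul]
    nth_rewrite 1 [h1]
    rw [neg_add_cancel]
  exact P.ne_zero α ((smul_eq_zero.1 h2).resolve_left two_ne_zero)

theorem reflectionPerm_self_eq_iff (α β : ι) :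
    P.reflectionPerm α α = β ↔ α = P.reflectionPerm β β := by
  constructor <;> rintro rfl <;> rw [reflectionPerm_self_self]

theorem neg_mem_rootsJ {J : Finset ι} (α : ι) :
    P.reflectionPerm α α ∈ rootsJ P J ↔ α ∈ rootsJ P J := by
  simp only [rootsJ, Set.mem_ofPred_eq, root_reflectionPerm_self, neg_mem_iff]

theorem refl_smul_mem_rootsJ [P.IsCrystallographic] {J : Finset ι} {α β : ι} (hα : α ∈ rootsJ P J)
    (hβ : β ∈ rootsJ P J) : refl P α • β ∈ rootsJ P J := by
  rw [rootsJ, Set.mem_ofPred_eq, root_refl_smul]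
  exact sub_mem hβ (Submodule.smul_mem _ _ hα)

open Classical in
/-- The sum of the coordinates of a vector at the simple roots outside `J`. -/
def coordSum [P.IsRootSystem] (J : Finset ι) : M →ₗ[ℝ] ℝ :=
  ∑ i : b.support, if (i : ι) ∈ J then 0 else b.toWeightBasis.coord i

variable [P.IsRootSystem]

open Classical in
theorem coordSum_simple (J : Finset ι) {i : ι} (hi : i ∈ b.support) :
    coordSum b J (P.root i) = if i ∈ J then 0 else 1 := by
  rw [coordSum, LinearMap.sum_apply, Finset.sum_eq_single ⟨i, hi⟩]
  · split_ifs with h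
    · rfl
    · simp [b.toWeightBasis_repr_root ⟨i, hi⟩]
  · rintro j - hj
    split_ifs with h
    · rfl
    · have := b.toWeightBasis_repr_root ⟨i, hi⟩
      simp only at this
      rw [Module.Basis.coord_apply, this, Finsupp.single_eq_of_ne hj]
  · simp

theorem coordSum_nonneg (J : Finset ι) {x : M}
    (hx : x ∈ AddSubmonoid.closure (P.root '' b.support)) : 0 ≤ coordSum b J x := by
  classical
  induction hx using AddSubmonoid.closure_induction with
  | mem x hx =>
    obtain ⟨i, hi, rfl⟩ := hx
    rw [coordSum_simple b J hi]
    split_ifs <;> norm_num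
  | zero => simp
  | add x y _ _ hx hy => rw [map_add]; exact add_nonneg hx hy

theorem mem_span_of_coordSum_eq_zero (J : Finset ι) {x : M}
    (hx : x ∈ AddSubmonoid.closure (P.root '' b.support)) (h : coordSum b J x = 0) :
    x ∈ Submodule.span ℤ (P.root '' J) := by
  classical
  induction hx using AddSubmonoid.closure_induction with
  | mem x hx =>
    obtain ⟨i, hi, rfl⟩ := hx
    rw [coordSum_simple b J hi] at h
    split_ifs at h with hJ
    · exact Submodule.subset_span ⟨i, hJ, rfl⟩
    · norm_num at h
  | zero => exact zero_mem _
  | add x y hx hy ihx ihy =>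
    rw [map_add] at h
    have h1 := coordSum_nonneg b J hx
    have h2 := coordSum_nonneg b J hy
    exact add_mem (ihx (by linarith)) (ihy (by linarith))

theorem coordSum_eq_zero_of_mem_span {J : Finset ι} (hJ : J ⊆ b.support) {x : M}
    (hx : x ∈ Submodule.span ℤ (P.root '' J)) : coordSum b J x = 0 := by
  classical
  induction hx using Submodule.span_induction with
  | mem x hx =>
    obtain ⟨i, hi, rfl⟩ := hx
    rw [coordSum_simple b J (hJ hi), if_pos (Finset.mem_coe.1 hi)]
  | zero => simp
  | add x y _ _ hx hy => rw [map_add, hx, hy, add_zero]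
  | smul a x _ hx => rw [map_zsmul, hx, smul_zero]

theorem height_cast (α : ι) : (b.height α : ℝ) = coordSum b ∅ (P.root α) := by
  obtain ⟨f, -, -, hf⟩ := b.exists_root_eq_sum_int α
  rw [RootPairing.Base.height_eq_sum hf, hf, map_sum, Int.cast_sum]
  refine Finset.sum_congr rfl fun i hi => ?_
  rw [map_zsmul, coordSum_simple b ∅ hi]
  simp

theorem isPos_iff_coordSum (α : ι) : b.IsPos α ↔ 0 < coordSum b ∅ (P.root α) := by
  rw [RootPairing.Base.isPos_iff, ← height_cast]
  exact Int.cast_pos.symm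

theorem isPos_iff_mem_closure (α : ι) :
    b.IsPos α ↔ P.root α ∈ AddSubmonoid.closure (P.root '' b.support) := by
  rw [RootPairing.Base.isPos_iff']
  constructor
  · intro h
    refine (b.root_mem_or_neg_mem α).resolve_right fun h' => b.height_ne_zero α ?_
    have h1 := coordSum_nonneg b ∅ h'
    rw [map_neg, ← height_cast] at h1
    have h2 : (b.height α : ℝ) ≤ 0 := by linarith
    exact le_antisymm (by exact_mod_cast h2) h
  · intro h
    have h1 := coordSum_nonneg b ∅ h
    rw [← height_cast] at h1
    exact_mod_cast h1

theorem mem_rootsJ_iff {J : Finset ι} (hJ : J ⊆ b.support) (α : ι) :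
    α ∈ rootsJ P J ↔ coordSum b J (P.root α) = 0 := by
  refine ⟨coordSum_eq_zero_of_mem_span b hJ, fun h => ?_⟩
  rcases b.root_mem_or_neg_mem α with h' | h'
  · exact mem_span_of_coordSum_eq_zero b J h' h
  · have := mem_span_of_coordSum_eq_zero b J h' (by rw [map_neg, h, neg_zero])
    exact neg_mem_iff.1 this

/-- One linear functional detects the positive roots outside `Φ_J` by its sign, so the effect of
reflections on this set can be read off linearly. -/
theorem isPos_and_notMem_iff {J : Finset ι} (hJ : J ⊆ b.support) (α : ι) :
    b.IsPos α ∧ α ∉ rootsJ P J ↔ 0 < coordSum b J (P.root α) := by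
  rw [mem_rootsJ_iff b hJ]
  constructor
  · rintro ⟨h1, h2⟩
    exact lt_of_le_of_ne (coordSum_nonneg b J ((isPos_iff_mem_closure b α).1 h1)) (Ne.symm h2)
  · intro h
    refine ⟨?_, h.ne'⟩
    by_contra h'
    rw [← isPos_neg_iff, isPos_iff_mem_closure, root_reflectionPerm_self] at h'
    have := coordSum_nonneg b J h'
    rw [map_neg] at this
    linarith

theorem coordSum_smul {J : Finset ι} (hJ : J ⊆ b.support) {u : P.weylGroup}
    (hu : u ∈ parabolic P J) (x : M) : coordSum b J (u • x) = coordSum b J x := by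
  classical
  induction hu using Subgroup.closure_induction generalizing x with
  | mem u hu =>
    obtain ⟨j, hj, rfl⟩ := hu
    rw [refl_smul_vec, P.reflection_apply, map_sub, map_smul, coordSum_simple b J (hJ hj),
      if_pos (Finset.mem_coe.1 hj), smul_zero, sub_zero]
  | one => rw [one_smul]
  | mul u v _ _ hu hv => rw [mul_smul, hu, hv]
  | inv u _ hu => rw [← hu (u⁻¹ • x), smul_inv_smul]

theorem smul_mem_rootsJ {J : Finset ι} (hJ : J ⊆ b.support) {u : P.weylGroup}
    (hu : u ∈ parabolic P J) (α : ι) : u • α ∈ rootsJ P J ↔ α ∈ rootsJ P J := by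
  rw [mem_rootsJ_iff b hJ, mem_rootsJ_iff b hJ, root_smul, coordSum_smul b hJ hu]

end Positivity

/-! ### The sign of a root and the shift of an affine Weyl group element -/

section Shift

variable (b : P.Base)

open Classical in
/-- The indicator of the negative roots. -/
def negInd (α : ι) : ℤ := if b.IsPos α then 0 else 1

theorem negInd_of_pos {α : ι} (h : b.IsPos α) : negInd b α = 0 := if_pos h

theorem negInd_of_not_pos {α : ι} (h : ¬ b.IsPos α) : negInd b α = 1 := if_neg h

theorem negInd_eq_zero_iff {α : ι} : negInd b α = 0 ↔ b.IsPos α := by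
  unfold negInd; split_ifs with h <;> simp [h]

theorem negInd_nonneg (α : ι) : 0 ≤ negInd b α := by
  unfold negInd; split_ifs <;> norm_num

theorem negInd_le_one (α : ι) : negInd b α ≤ 1 := by
  unfold negInd; split_ifs <;> norm_num

theorem negInd_neg (α : ι) : negInd b (P.reflectionPerm α α) = 1 - negInd b α := by
  unfold negInd
  rw [isPos_neg_iff]
  split_ifs <;> simp_all

theorem affPos_iff (γ : AffRoot P) : AffPos b γ ↔ negInd b γ.1 ≤ γ.2 := by
  unfold AffPos negInd
  split_ifs with h
  · simp only [h, and_true]; omega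
  · simp only [h, and_false, or_false]; omega

theorem affNeg_iff (γ : AffRoot P) : AffNeg b γ ↔ ¬ AffPos b γ := by
  unfold AffNeg
  rw [affPos_iff, affPos_iff, negInd_neg]
  simp only
  omega

theorem toAdd_left_mul (x y : AffWeyl P) : Multiplicative.toAdd (x * y).left =
    Multiplicative.toAdd x.left + latticeEquiv x.right (Multiplicative.toAdd y.left) := rfl

open Classical in
theorem two_mul_sum_pos [Fintype ι] (f : ι → ℕ) (hf : ∀ α, f (P.reflectionPerm α α) = f α) :
    2 * ∑ α with b.IsPos α, f α = ∑ α, f α := by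
  rw [← Finset.sum_filter_add_sum_filter_not Finset.univ (b.IsPos ·) f, two_mul]
  congr 1
  refine Finset.sum_bij' (fun α _ => P.reflectionPerm α α) (fun α _ => P.reflectionPerm α α)
    ?_ ?_ ?_ ?_ ?_
  · intro α hα
    simpa [isPos_neg_iff] using hα
  · intro α hα
    simpa [isPos_neg_iff] using hα
  · intro α _; exact reflectionPerm_self_self α
  · intro α _; exact reflectionPerm_self_self α
  · intro α _; rw [hf]

variable [P.IsCrystallographic]

/-- The affine Weyl group element `x` maps `α + n δ` to a positive root if and only if
`n - [α < 0]` is at least `shift b x α`. -/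
def shift (x : AffWeyl P) (α : ι) : ℤ :=
  pair (Multiplicative.toAdd x.left) (x.right • α) + negInd b (x.right • α) - negInd b α

theorem affPos_affAct_iff (x : AffWeyl P) (γ : AffRoot P) :
    AffPos b (affAct x γ) ↔ shift b x γ.1 + negInd b γ.1 ≤ γ.2 := by
  rw [affPos_iff]
  simp only [affAct, shift]
  omega

theorem shift_neg (x : AffWeyl P) (α : ι) :
    shift b x (P.reflectionPerm α α) = - shift b x α := by
  simp only [shift, smul_reflectionPerm_self, pair_neg_root, negInd_neg]
  ring

/-- This cocycle rule reduces all shifts to those of `W` and of translations. -/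
theorem shift_mul (x y : AffWeyl P) (α : ι) :
    shift b (x * y) α = shift b x (y.right • α) + shift b y α := by
  simp only [shift, toAdd_left_mul, SemidirectProduct.mul_right, mul_smul, map_add,
    pair_latticeEquiv]
  ring

theorem shift_fin (w : P.weylGroup) (α : ι) :
    shift b (fin w) α = negInd b (w • α) - negInd b α := by
  simp [shift]

theorem shift_transl (μ : P.corootSpan ℤ) (α : ι) : shift b (transl μ) α = pair μ α := by
  simp [shift]

theorem shift_fin_mul_transl (w : P.weylGroup) (μ : P.corootSpan ℤ) (α : ι) :
    shift b (fin w * transl μ) α = pair μ α + negInd b (w • α) - negInd b α := by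
  rw [shift_mul, shift_fin, shift_transl, SemidirectProduct.right_inl, one_smul]
  ring

instance affMulAction : MulAction (AffWeyl P) (AffRoot P) where
  smul := affAct
  one_smul γ := by
    change affAct 1 γ = γ
    simp [affAct]
  mul_smul x y γ := by
    change affAct (x * y) γ = affAct x (affAct y γ)
    simp only [affAct, toAdd_left_mul, SemidirectProduct.mul_right, mul_smul, map_add,
      pair_latticeEquiv]
    congr 1
    ring

theorem aff_smul_def (x : AffWeyl P) (γ : AffRoot P) : x • γ = affAct x γ := rfl

variable [Fintype ι]

open Classical in
/-- The number of positive affine roots made negative by `x`. -/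
def inversions (x : AffWeyl P) : ℕ := ∑ α with b.IsPos α, (shift b x α).natAbs

/-- If `y` acts on the roots by a reflection and shifts only the roots `±a`, then right
multiplication by `y` changes the number of inversions by one. -/
theorem inversions_mul {a : ι} {y : AffWeyl P} (hy : y.right = refl P a) (hya : shift b y a = 1)
    (hy0 : ∀ α, α ≠ a → α ≠ P.reflectionPerm a a → shift b y α = 0) {x : AffWeyl P}
    (hx : shift b x a ≤ 0) : inversions b (x * y) = inversions b x + 1 := by
  classical
  have hne := reflectionPerm_self_ne (P := P) a
  have hsymm : ∀ (z : AffWeyl P) (α : ι),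
      (shift b z (P.reflectionPerm α α)).natAbs = (shift b z α).natAbs := by
    intro z α; rw [shift_neg, Int.natAbs_neg]
  -- The sum runs over all roots, counting each pair `±α` twice, because `r_a` permutes all roots
  -- but need not preserve the positive ones.
  have hsum : ∑ α, (shift b (x * y) α).natAbs = ∑ α, ((shift b x α).natAbs +
      ((if α = a then 1 else 0) + if α = P.reflectionPerm a a then 1 else 0)) := by
    rw [← Equiv.sum_comp (P.reflectionPerm a) fun α => (shift b (x * y) α).natAbs]
    refine Finset.sum_congr rfl fun α _ => ?_
    rw [shift_mul, hy, ← refl_smul (P := P) a α, refl_smul_refl_smul]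
    by_cases h1 : α = a
    · subst h1
      rw [refl_smul, shift_neg, hya, if_pos rfl, if_neg hne.symm]
      omega
    by_cases h2 : α = P.reflectionPerm a a
    · subst h2
      rw [refl_smul, P.reflectionPerm_self, hya, if_neg h1, if_pos rfl, shift_neg]
      omega
    · rw [hy0, if_neg h1, if_neg h2]
      · simp
      · intro h
        apply h2
        rw [← refl_smul_refl_smul (P := P) a α, h, refl_smul]
      · intro h
        apply h1
        rw [← refl_smul_refl_smul (P := P) a α, h, refl_smul, P.reflectionPerm_self]
  have h1 := two_mul_sum_pos b (fun α => (shift b x α).natAbs) (hsymm x)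
  have h2 := two_mul_sum_pos b (fun α => (shift b (x * y) α).natAbs) (hsymm (x * y))
  rw [hsum, Finset.sum_add_distrib, Finset.sum_add_distrib, Finset.sum_ite_eq', Finset.sum_ite_eq',
    if_pos (Finset.mem_univ _), if_pos (Finset.mem_univ _), ← h1] at h2
  unfold inversions
  omega

variable [P.IsReduced]

theorem negInd_refl_smul_simple {i : ι} (hi : i ∈ b.support) {α : ι} (h1 : α ≠ i)
    (h2 : α ≠ P.reflectionPerm i i) : negInd b (refl P i • α) = negInd b α := by
  have key : ∀ β, β ≠ i → b.IsPos β → negInd b (refl P i • β) = negInd b β := by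
    intro β hβ h
    rw [negInd_of_pos b h, negInd_of_pos b]
    exact h.reflectionPerm hi hβ
  by_cases h : b.IsPos α
  · exact key α h1 h
  · have := key (P.reflectionPerm α α) (by rwa [ne_eq, reflectionPerm_self_eq_iff])
      ((isPos_neg_iff b α).2 h)
    rw [smul_reflectionPerm_self, negInd_neg, negInd_neg] at this
    omega

/-- The finite Weyl group acting on the roots. -/
def finiteSystem : ReflectionSystem P.weylGroup ι where
  pos := b.IsPos
  neg α := P.reflectionPerm α α
  refl := refl P
  Δ := b.support
  L w := inversions b (fin w)
  refl_smul := refl_conj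
  refl_mul_self := refl_mul_self
  refl_neg := refl_reflectionPerm_self
  pos_neg := isPos_neg_iff b
  smul_neg := smul_reflectionPerm_self
  refl_smul_self _ := rfl
  pos_of_mem _ := RootPairing.Base.isPos_of_mem_support
  eq_of_not_pos := by
    intro a ha β hβ h
    by_contra hne
    exact h (hβ.reflectionPerm ha hne)
  closure_eq_top := weylGroup_closure b
  L_one := by
    simp [inversions, shift]
  L_mul := by
    intro a ha w hw
    rw [show fin (w * refl P a) = fin w * fin (refl P a) from map_mul _ _ _]
    have hpos := RootPairing.Base.isPos_of_mem_support ha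
    refine inversions_mul b (a := a) rfl ?_ ?_ ?_
    · rw [shift_fin, refl_smul, negInd_neg, negInd_of_pos b hpos]
      norm_num
    · intro α h1 h2
      rw [shift_fin, negInd_refl_smul_simple b ha h1 h2, sub_self]
    · rw [shift_fin, negInd_of_pos b hpos, negInd_of_pos b hw, sub_self]

end Shift

/-! ### The highest root -/

section Highest

variable (b : P.Base)

theorem pairingIn_eq_sum [P.IsCrystallographic] {f : ι → ℤ} {s : Finset ι} {α : ι}
    (h : P.root α = ∑ i ∈ s, f i • P.root i) (β : ι) :
    P.pairingIn ℤ α β = ∑ i ∈ s, f i * P.pairingIn ℤ i β := by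
  refine FaithfulSMul.algebraMap_injective ℤ ℝ ?_
  simp_rw [map_sum, map_mul, P.algebraMap_pairingIn, ← P.root_coroot_eq_pairing, h, map_sum,
    map_zsmul, LinearMap.coe_sum, Finset.sum_apply, LinearMap.smul_apply, zsmul_eq_mul]
  rfl

variable [P.IsRootSystem]

theorem eq_of_sub_mem_closure {α β : ι}
    (h : P.root α - P.root β ∈ AddSubmonoid.closure (P.root '' b.support))
    (hle : b.height α ≤ b.height β) : α = β := by
  have h1 := coordSum_nonneg b ∅ h
  have h2 : coordSum b ∅ (P.root α - P.root β) = 0 := by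
    refine le_antisymm ?_ h1
    rw [map_sub, ← height_cast, ← height_cast, sub_nonpos]
    exact_mod_cast hle
  have h3 := mem_span_of_coordSum_eq_zero b ∅ h h2
  simp only [Finset.coe_empty, Set.image_empty, Submodule.span_empty, Submodule.mem_bot] at h3
  exact P.root.injective (sub_eq_zero.1 h3)

theorem height_le_of_sub_mem_closure {α β : ι}
    (h : P.root α - P.root β ∈ AddSubmonoid.closure (P.root '' b.support)) :
    b.height β ≤ b.height α := by
  have h1 := coordSum_nonneg b ∅ h
  rw [map_sub, ← height_cast, ← height_cast, sub_nonneg] at h1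
  exact_mod_cast h1

/-- The root `γ` is maximal in the root poset. -/
def IsMaximalRoot (γ : ι) : Prop :=
  ∀ δ, P.root δ - P.root γ ∈ AddSubmonoid.closure (P.root '' b.support) → δ = γ

theorem exists_isMaximalRoot [Finite ι] (β : ι) :
    ∃ γ, P.root γ - P.root β ∈ AddSubmonoid.closure (P.root '' b.support) ∧
      IsMaximalRoot b γ := by
  obtain ⟨γ, hγ, hmax⟩ := Set.exists_max_image
    {γ | P.root γ - P.root β ∈ AddSubmonoid.closure (P.root '' b.support)} b.height
    (Set.toFinite _) ⟨β, by simp⟩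
  refine ⟨γ, hγ, fun δ hδ => eq_of_sub_mem_closure b hδ (hmax δ ?_)⟩
  have := add_mem hδ hγ
  rwa [sub_add_sub_cancel] at this

variable {b}

theorem IsHighestRoot.height_le {θ : ι} (h : IsHighestRoot b θ) (α : ι) :
    b.height α ≤ b.height θ :=
  height_le_of_sub_mem_closure b (h α)

theorem IsHighestRoot.eq_of_height_le {θ α : ι} (h : IsHighestRoot b θ)
    (hα : b.height θ ≤ b.height α) : α = θ :=
  (eq_of_sub_mem_closure b (h α) hα).symm

theorem IsHighestRoot.neg_height_le {θ : ι} (h : IsHighestRoot b θ) (α : ι) :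
    - b.height θ ≤ b.height α := by
  have h1 : b.height (P.reflectionPerm α α) = - b.height α := b.height_reflectionPerm_self α
  have := h.height_le (P.reflectionPerm α α)
  omega

theorem IsHighestRoot.isPos {θ : ι} (h : IsHighestRoot b θ) : b.IsPos θ := by
  rw [RootPairing.Base.isPos_iff']
  have h1 := h.neg_height_le θ
  omega

theorem IsMaximalRoot.isPos {γ : ι} (h : IsMaximalRoot b γ) : b.IsPos γ := by
  by_contra hneg
  rw [← isPos_neg_iff, isPos_iff_mem_closure, root_reflectionPerm_self] at hneg
  refine reflectionPerm_self_ne (P := P) γ (h _ ?_)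
  rw [root_reflectionPerm_self, sub_eq_add_neg]
  exact add_mem hneg hneg

variable [P.IsCrystallographic]

theorem IsMaximalRoot.pairingIn_nonneg {γ i : ι} (h : IsMaximalRoot b γ) (hi : i ∈ b.support) :
    0 ≤ P.pairingIn ℤ γ i := by
  by_contra! hneg
  obtain ⟨n, hn⟩ := Int.eq_ofNat_of_zero_le (a := -P.pairingIn ℤ γ i) (by omega)
  have hr : P.root (refl P i • γ) - P.root γ = n • P.root i := by
    rw [root_refl_smul, sub_sub_cancel_left, ← neg_smul, hn, natCast_zsmul]
  have h1 := h (refl P i • γ) (by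
    rw [hr]; exact nsmul_mem (AddSubmonoid.subset_closure (Set.mem_image_of_mem _ hi)) n)
  rw [h1, sub_self, ← Nat.cast_smul_eq_nsmul ℝ] at hr
  rcases smul_eq_zero.1 hr.symm with h2 | h2
  · have : n = 0 := by exact_mod_cast h2
    omega
  · exact P.ne_zero i h2

/-- With `0 < ht α < ht θ`, any other value of the pairing would put the height of `r_θ α` outside
the interval from `-ht θ` to `ht θ`. -/
theorem IsHighestRoot.pairingIn_mem {θ α : ι} (h : IsHighestRoot b θ)
    (hα : b.IsPos α) (hne : α ≠ θ) : P.pairingIn ℤ α θ = 0 ∨ P.pairingIn ℤ α θ = 1 := by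
  have hr : b.height (refl P θ • α) = b.height α - P.pairingIn ℤ α θ * b.height θ := by
    have := b.height_add_zsmul (i := α) (j := θ) (k := refl P θ • α)
      (z := - P.pairingIn ℤ α θ) (by rw [root_refl_smul, neg_smul, sub_eq_add_neg])
    rw [this, smul_eq_mul]
    ring
  have h1 := h.height_le (refl P θ • α)
  have h2 := h.neg_height_le (refl P θ • α)
  have h3 : 0 < b.height α := hα
  have h4 : 0 < b.height θ := h.isPos
  have h5 : ¬ b.height θ ≤ b.height α := fun h' => hne (h.eq_of_height_le h')
  rw [hr] at h1 h2
  have h6 : 0 ≤ P.pairingIn ℤ α θ := by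
    by_contra! hlt
    nlinarith
  have h7 : P.pairingIn ℤ α θ ≤ 1 := by
    by_contra! hlt
    nlinarith
  omega

variable [Finite ι] [P.IsReduced]

/-- Let `K` be the set of simple roots occurring in `γ`. For `j ∉ K`, the number `⟨γ, j^∨⟩` is
nonnegative by maximality and a sum of nonpositive terms, so `j` is orthogonal to `K`. The span of
`K` is thus invariant under all reflections, and irreducibility makes it everything. -/
theorem IsMaximalRoot.exists_sum [P.IsIrreducible] {γ : ι} (h : IsMaximalRoot b γ) :
    ∃ f : ι → ℤ, (∀ i ∈ b.support, 0 < f i) ∧ P.root γ = ∑ i ∈ b.support, f i • P.root i := by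
  classical
  obtain ⟨f, -, hf, hsum⟩ := b.exists_root_eq_sum_int γ
  have hpos := h.isPos
  rw [RootPairing.Base.isPos_iff, RootPairing.Base.height_eq_sum hsum] at hpos
  have hf0 : ∀ i, 0 ≤ f i := by
    rcases hf with hf | hf
    · exact hf.le
    · exact absurd hpos (not_lt.2 (Finset.sum_nonpos fun i _ => hf.le i))
  refine ⟨f, ?_, hsum⟩
  set K := b.support.filter fun i => f i ≠ 0 with hK
  have horth : ∀ i ∈ K, ∀ j ∈ b.support, j ∉ K → P.pairingIn ℤ i j = 0 := by
    intro i hi j hj hjK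
    have h1 := h.pairingIn_nonneg hj
    rw [pairingIn_eq_sum hsum] at h1
    have hle : ∀ i ∈ b.support, f i * P.pairingIn ℤ i j ≤ 0 := by
      intro i hi
      by_cases hij : i = j
      · subst hij
        have : f i = 0 := by
          by_contra hne
          exact hjK (Finset.mem_filter.2 ⟨hi, hne⟩)
        rw [this, zero_mul]
      · exact mul_nonpos_of_nonneg_of_nonpos (hf0 i) (b.pairingIn_le_zero_of_ne hij hi hj)
    have h2 := (Finset.sum_eq_zero_iff_of_nonpos hle).1
      (le_antisymm (Finset.sum_nonpos hle) h1) i (Finset.mem_filter.1 hi).1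
    exact (mul_eq_zero.1 h2).resolve_left (Finset.mem_filter.1 hi).2
  have hmem : P.root γ ∈ Submodule.span ℝ (P.root '' K) := by
    rw [hsum]
    refine Submodule.sum_mem _ fun i hi => ?_
    by_cases hi0 : f i = 0
    · rw [hi0, zero_smul]; exact zero_mem _
    · exact zsmul_mem (Submodule.subset_span
        (Set.mem_image_of_mem _ (Finset.mem_coe.2 (Finset.mem_filter.2 ⟨hi, hi0⟩)))) _
  have htop : Submodule.span ℝ (P.root '' K) = ⊤ := by
    refine RootPairing.IsIrreducible.eq_top_of_invtSubmodule_reflection (P := P) _ ?_ ?_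
    · refine (b.forall_mem_support_invtSubmodule_iff _).1 fun j hj => ?_
      rw [Module.End.mem_invtSubmodule, Submodule.span_le]
      rintro _ ⟨i, hi, rfl⟩
      simp only [Submodule.comap_coe, Set.mem_preimage, LinearEquiv.coe_coe, SetLike.mem_coe]
      rw [P.reflection_apply_root' ℤ]
      refine sub_mem (Submodule.subset_span ⟨i, hi, rfl⟩) ?_
      by_cases hjK : j ∈ K
      · exact zsmul_mem (Submodule.subset_span (Set.mem_image_of_mem _ hjK)) _
      · rw [horth i hi j hj hjK, zero_smul]; exact zero_mem _
    · intro hbot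
      rw [hbot, Submodule.mem_bot] at hmem
      exact P.ne_zero γ hmem
  intro j hj
  refine lt_of_le_of_ne (hf0 j) fun h0 => ?_
  have hjK : j ∉ K := fun hjK => (Finset.mem_filter.1 hjK).2 h0.symm
  have hker : Submodule.span ℝ (P.root '' K) ≤ LinearMap.ker (coordSum b K) := by
    rw [Submodule.span_le]
    rintro _ ⟨i, hi, rfl⟩
    simp only [SetLike.mem_coe, LinearMap.mem_ker]
    rw [coordSum_simple b K (Finset.mem_filter.1 hi).1, if_pos (Finset.mem_coe.1 hi)]
  have := hker (htop ▸ Submodule.mem_top : P.root j ∈ _)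
  rw [LinearMap.mem_ker, coordSum_simple b K hj, if_neg hjK] at this
  exact one_ne_zero this

/-- Full support makes `⟨γ, δ^∨⟩` positive, so if `γ ≠ δ` then `γ - δ` is a root. Whatever its sign,
this contradicts maximality of one of the two. -/
theorem IsMaximalRoot.eq [P.IsIrreducible] {γ δ : ι} (hγ : IsMaximalRoot b γ)
    (hδ : IsMaximalRoot b δ) : γ = δ := by
  obtain ⟨f, hf, hfs⟩ := hγ.exists_sum
  obtain ⟨g, hg, hgs⟩ := hδ.exists_sum
  have hnn : ∀ i ∈ b.support, 0 ≤ P.pairingIn ℤ i δ := by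
    intro i hi
    have h1 := hδ.pairingIn_nonneg hi
    rcases h1.eq_or_lt with h1 | h1
    · exact (P.pairingIn_eq_zero_iff.1 h1.symm).ge
    · exact ((P.zero_lt_pairingIn_iff' ℤ).1 h1).le
  have hterm : ∀ i ∈ b.support, 0 ≤ f i * P.pairingIn ℤ i δ := fun i hi =>
    mul_nonneg (hf i hi).le (hnn i hi)
  have hpos : 0 < P.pairingIn ℤ γ δ := by
    rw [pairingIn_eq_sum hfs]
    refine lt_of_le_of_ne (Finset.sum_nonneg hterm) fun h0 => ?_
    have h1 := (Finset.sum_eq_zero_iff_of_nonneg hterm).1 h0.symm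
    have h2 : P.pairingIn ℤ δ δ = 0 := by
      rw [pairingIn_eq_sum hgs]
      refine Finset.sum_eq_zero fun i hi => ?_
      rw [(mul_eq_zero.1 (h1 i hi)).resolve_left (hf i hi).ne', mul_zero]
    rw [P.pairingIn_same] at h2
    norm_num at h2
  by_contra hne
  obtain ⟨ε, hε⟩ := P.root_sub_root_mem_of_pairingIn_pos hpos hne
  by_cases h : b.IsPos ε
  · rw [isPos_iff_mem_closure, hε] at h
    exact hne (hδ _ h)
  · rw [← isPos_neg_iff, isPos_iff_mem_closure, root_reflectionPerm_self, hε, neg_sub] at h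
    exact hne (hγ _ h).symm

theorem exists_isHighestRoot [P.IsIrreducible] (b : P.Base) : ∃ θ, IsHighestRoot b θ := by
  have : Nonempty ι := by
    by_contra hempty
    rw [not_nonempty_iff] at hempty
    have htop := RootPairing.IsRootSystem.span_root_eq_top (P := P)
    change Submodule.span ℝ (Set.range P.root) = ⊤ at htop
    rw [Set.range_eq_empty, Submodule.span_empty] at htop
    have := Submodule.subsingleton_iff ℝ |>.1 (subsingleton_of_bot_eq_top htop)
    exact RootPairing.not_isIrreducible_of_subsingleton P inferInstance
  obtain ⟨θ, -, hθ⟩ := exists_isMaximalRoot b (Classical.arbitrary ι)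
  refine ⟨θ, fun β => ?_⟩
  obtain ⟨γ, h1, h2⟩ := exists_isMaximalRoot b β
  rwa [h2.eq hθ] at h1

end Highest

/-! ### Lattice vectors with small pairings -/

section Minuscule

variable [Finite ι] [P.IsCrystallographic] [P.IsReduced]

/-- If `α ≠ -β`, one of the two negative Cartan integers is `-1`, and the corresponding reflection
adds the coroots. -/
theorem coroot_add_coroot {Ψ : Set ι} (hΨ : ∀ α ∈ Ψ, ∀ β ∈ Ψ, refl P α • β ∈ Ψ) {α β : ι}
    (hα : α ∈ Ψ) (hβ : β ∈ Ψ) (h : P.pairingIn ℤ α β < 0) :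
    P.coroot α + P.coroot β = 0 ∨ ∃ γ ∈ Ψ, P.coroot γ = P.coroot α + P.coroot β := by
  have hco : ∀ α β, P.coroot (refl P α • β) = P.coroot β - P.pairingIn ℤ α β • P.coroot α := by
    intro α β
    have := congrArg Subtype.val (latticeEquiv_refl (P := P) α (P.corootSpanMem ℤ β))
    rw [latticeEquiv_coroot] at this
    exact this
  by_cases h1 : P.root α = P.root β
  · rw [P.root.injective h1, P.pairingIn_same] at h
    norm_num at h
  by_cases h2 : P.root α = - P.root β
  · left
    have : α = P.reflectionPerm β β := P.root.injective (by rw [h2, root_reflectionPerm_self])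
    rw [this]
    simp
  right
  have h3 := P.pairingIn_pairingIn_mem_set_of_isCrystal_of_isRed' α β h1 h2
  have h4 : P.pairingIn ℤ α β = -1 ∨ P.pairingIn ℤ β α = -1 := by
    simp only [Set.mem_insert_iff, Set.mem_singleton_iff, Prod.mk.injEq] at h3
    omega
  rcases h4 with h4 | h4
  · exact ⟨_, hΨ α hα β hβ, by rw [hco, h4, neg_smul, one_smul, sub_neg_eq_add, add_comm]⟩
  · exact ⟨_, hΨ β hβ α hα, by rw [hco, h4, neg_smul, one_smul, sub_neg_eq_add]⟩

theorem exists_multiset_coroot {Ψ : Set ι} (hΨ : ∀ α ∈ Ψ, ∀ β ∈ Ψ, refl P α • β ∈ Ψ) {x : N}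
    (hx : x ∈ Submodule.span ℤ (P.coroot '' Ψ)) :
    ∃ s : Multiset ι, (∀ α ∈ s, α ∈ Ψ) ∧ (s.map P.coroot).sum = x := by
  rw [← Submodule.mem_toAddSubgroup, Submodule.span_int_eq_addSubgroupClosure] at hx
  induction hx using AddSubgroup.closure_induction with
  | mem x hx =>
    obtain ⟨α, hα, rfl⟩ := hx
    exact ⟨{α}, by simpa, by simp⟩
  | zero => exact ⟨0, by simp, by simp⟩
  | add x y _ _ hx hy =>
    obtain ⟨s, hs, rfl⟩ := hx
    obtain ⟨t, ht, rfl⟩ := hy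
    refine ⟨s + t, fun α hα => ?_, by simp⟩
    rcases Multiset.mem_add.1 hα with h | h
    exacts [hs α h, ht α h]
  | neg x _ hx =>
    obtain ⟨s, hs, rfl⟩ := hx
    refine ⟨s.map fun α => refl P α • α, fun α hα => ?_, ?_⟩
    · obtain ⟨β, hβ, rfl⟩ := Multiset.mem_map.1 hα
      exact hΨ β (hs β hβ) β (hs β hβ)
    · rw [Multiset.map_map, ← Multiset.sum_map_neg', Multiset.map_map]
      refine congrArg Multiset.sum (Multiset.map_congr rfl fun α _ => ?_)
      simp [refl_smul]

/-- Write `ν` as a sum of coroots of `Ψ`. A summand `α^∨` contributes two to `⟨ν, α⟩ ≤ 1`, so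
another summand `β^∨` pairs negatively with `α`; then `α^∨ + β^∨` is zero or a coroot of `Ψ`, and
the expression can be shortened until it is empty. -/
theorem eq_zero_of_pair_le_one {Ψ : Set ι} (hΨ : ∀ α ∈ Ψ, ∀ β ∈ Ψ, refl P α • β ∈ Ψ)
    {ν : P.corootSpan ℤ} (hν : (ν : N) ∈ Submodule.span ℤ (P.coroot '' Ψ))
    (h : ∀ β ∈ Ψ, pair ν β ≤ 1) : ν = 0 := by
  classical
  obtain ⟨s, hs, hsum⟩ := exists_multiset_coroot hΨ hν
  induction hn : s.card using Nat.strong_induction_on generalizing s with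
  | _ n ih =>
    rcases s.empty_or_exists_mem with rfl | ⟨α, hα⟩
    · ext; simpa using hsum.symm
    obtain ⟨t, rfl⟩ := Multiset.exists_cons_of_mem hα
    have hαΨ := hs α hα
    have hpair : pair ν α = 2 + (t.map fun β => P.pairingIn ℤ α β).sum := by
      have hν' : ν = ((α ::ₘ t).map (P.corootSpanMem ℤ)).sum := by
        ext
        rw [← hsum]
        have := map_multiset_sum (P.corootSpan ℤ).subtype ((α ::ₘ t).map (P.corootSpanMem ℤ))
        rw [Multiset.map_map] at this
        exact this.symm
      rw [hν', pair, map_multiset_sum, Multiset.map_map, Multiset.map_cons, Multiset.sum_cons]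
      congr 1
      exact P.pairingIn_same ℤ α
    have h1 := h α hαΨ
    obtain ⟨β, hβ, hneg⟩ : ∃ β ∈ t, P.pairingIn ℤ α β < 0 := by
      by_contra! hcon
      have : 0 ≤ (t.map fun β => P.pairingIn ℤ α β).sum := by
        refine Multiset.sum_nonneg fun x hx => ?_
        obtain ⟨β, hβ, rfl⟩ := Multiset.mem_map.1 hx
        exact hcon β hβ
      omega
    obtain ⟨t, rfl⟩ := Multiset.exists_cons_of_mem hβ
    simp only [Multiset.map_cons, Multiset.sum_cons, Multiset.card_cons] at hsum hn
    rw [← add_assoc] at hsum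
    have ht : ∀ α ∈ t, α ∈ Ψ := fun γ hγ => hs γ (by simp [hγ])
    rcases coroot_add_coroot hΨ hαΨ (hs β (by simp)) hneg with h2 | ⟨γ, hγ, h2⟩
    · exact ih t.card (by omega) t ht (by rw [← hsum, h2, zero_add]) rfl
    · refine ih (γ ::ₘ t).card (by simp; omega) (γ ::ₘ t) ?_ (by simp [h2, hsum]) rfl
      intro δ hδ
      rcases Multiset.mem_cons.1 hδ with rfl | hδ
      exacts [hγ, ht δ hδ]

end Minuscule

/-! ### The affine Weyl group as a reflection system -/

section AffineSystem

/-- The simple affine roots: the `α_i` and `-θ + δ`. -/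
def affSimpleRoots (b : P.Base) : Set (AffRoot P) :=
  {γ | (∃ i ∈ b.support, γ = (i, 0)) ∨ ∃ θ, IsHighestRoot b θ ∧ γ = (P.reflectionPerm θ θ, 1)}

theorem image_affSimpleRoots (b : P.Base) : affRefl '' affSimpleRoots b = affSimpleRefls b := by
  ext x
  constructor
  · rintro ⟨γ, ⟨i, hi, rfl⟩ | ⟨θ, hθ, rfl⟩, rfl⟩
    · exact Or.inl ⟨i, hi, rfl⟩
    · exact Or.inr ⟨θ, hθ, rfl⟩
  · rintro (⟨i, hi, rfl⟩ | ⟨θ, hθ, rfl⟩)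
    · exact ⟨_, Or.inl ⟨i, hi, rfl⟩, rfl⟩
    · exact ⟨_, Or.inr ⟨θ, hθ, rfl⟩, rfl⟩

theorem affRefl_right (γ : AffRoot P) : (affRefl γ).right = refl P γ.1 := by
  simp [affRefl]

theorem aff_ext {x y : AffWeyl P}
    (h1 : Multiplicative.toAdd x.left = Multiplicative.toAdd y.left) (h2 : x.right = y.right) :
    x = y :=
  SemidirectProduct.ext h1 h2

variable [P.IsCrystallographic]

theorem affRefl_left (γ : AffRoot P) :
    Multiplicative.toAdd (affRefl γ).left = -(γ.2 • P.corootSpanMem ℤ γ.1) := by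
  have h : Multiplicative.toAdd (affRefl γ).left =
      latticeEquiv (refl P γ.1) (γ.2 • P.corootSpanMem ℤ γ.1) := by
    rw [affRefl, toAdd_left_mul]
    simp
  rw [h, map_zsmul, latticeEquiv_coroot, refl_smul, P.corootSpanMem_reflectionPerm_self, smul_neg]

theorem pair_zsmul_coroot (n : ℤ) (α β : ι) :
    pair (n • P.corootSpanMem ℤ α) β = n * P.pairingIn ℤ β α := by
  rw [pair, map_zsmul, smul_eq_mul]
  rfl

theorem affRefl_conj (x : AffWeyl P) (γ : AffRoot P) :
    affRefl (x • γ) = x * affRefl γ * x⁻¹ := by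
  rw [eq_mul_inv_iff_mul_eq]
  apply aff_ext
  · rw [toAdd_left_mul, toAdd_left_mul, affRefl_left, affRefl_left, affRefl_right,
      latticeEquiv_refl, map_neg, map_zsmul, latticeEquiv_coroot, aff_smul_def]
    simp only [affAct]
    module
  · rw [SemidirectProduct.mul_right, SemidirectProduct.mul_right, affRefl_right, affRefl_right]
    change refl P (x.right • γ.1) * _ = _
    rw [refl_conj, inv_mul_cancel_right]

theorem affRefl_mul_self (γ : AffRoot P) : affRefl γ * affRefl γ = 1 := by
  apply aff_ext
  · rw [toAdd_left_mul, affRefl_left, affRefl_right, map_neg, map_zsmul, latticeEquiv_coroot,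
      refl_smul, P.corootSpanMem_reflectionPerm_self, smul_neg, neg_neg, neg_add_cancel]
    rfl
  · rw [SemidirectProduct.mul_right, affRefl_right, refl_mul_self]
    rfl

theorem affRefl_neg (γ : AffRoot P) :
    affRefl (P.reflectionPerm γ.1 γ.1, -γ.2) = affRefl γ := by
  apply aff_ext
  · rw [affRefl_left, affRefl_left, P.corootSpanMem_reflectionPerm_self]
    simp
  · rw [affRefl_right, affRefl_right, refl_reflectionPerm_self]

variable (b : P.Base)

theorem shift_affRefl (γ : AffRoot P) (α : ι) : shift b (affRefl γ) α =
    γ.2 * P.pairingIn ℤ α γ.1 + negInd b (refl P γ.1 • α) - negInd b α := by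
  rw [affRefl, shift_fin_mul_transl, pair_zsmul_coroot]

theorem shift_affRefl_self (γ : AffRoot P) (h : γ.2 = negInd b γ.1) :
    shift b (affRefl γ) γ.1 = 1 := by
  rw [shift_affRefl, h, P.pairingIn_same, refl_smul, negInd_neg]
  ring

theorem snd_of_mem_affSimpleRoots [P.IsRootSystem] {γ : AffRoot P} (hγ : γ ∈ affSimpleRoots b) :
    γ.2 = negInd b γ.1 := by
  rcases hγ with ⟨i, hi, rfl⟩ | ⟨θ, hθ, rfl⟩
  · rw [negInd_of_pos b (RootPairing.Base.isPos_of_mem_support hi)]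
  · rw [negInd_neg, negInd_of_pos b hθ.isPos, sub_zero]

/-- Either `⟨α, θ^∨⟩ = 0` and `α` is fixed, or `⟨α, θ^∨⟩ = 1` and `r_θ α = α - θ` is negative; in
the second case the change of sign compensates the translation by `δ`. -/
theorem shift_highest_of_isPos [P.IsRootSystem] {θ : ι} (hθ : IsHighestRoot b θ) {α : ι}
    (hα : b.IsPos α) (h1 : α ≠ θ) : shift b (affRefl (P.reflectionPerm θ θ, 1)) α = 0 := by
  rw [shift_affRefl]
  simp only [refl_reflectionPerm_self, P.pairingIn_reflectionPerm_self_right, one_mul]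
  rw [negInd_of_pos b hα]
  rcases hθ.pairingIn_mem hα h1 with h | h
  · have : refl P θ • α = α := P.root.injective (by rw [root_refl_smul, h, zero_smul, sub_zero])
    rw [h, this, negInd_of_pos b hα]
    rfl
  · have hroot : P.root (P.reflectionPerm (refl P θ • α) (refl P θ • α)) =
        P.root θ - P.root α := by
      rw [root_reflectionPerm_self, root_refl_smul, h, one_smul, neg_sub]
    have hpos : ¬ b.IsPos (refl P θ • α) := by
      rw [← isPos_neg_iff, isPos_iff_mem_closure, hroot]
      exact hθ α
    rw [h, negInd_of_not_pos b hpos]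
    norm_num

theorem shift_affRefl_of_ne [P.IsRootSystem] [Finite ι] [P.IsReduced] {γ : AffRoot P}
    (hγ : γ ∈ affSimpleRoots b) {α : ι} (h1 : α ≠ γ.1) (h2 : α ≠ P.reflectionPerm γ.1 γ.1) :
    shift b (affRefl γ) α = 0 := by
  have := Fintype.ofFinite ι
  rcases hγ with ⟨i, hi, rfl⟩ | ⟨θ, hθ, rfl⟩
  · rw [shift_affRefl, negInd_refl_smul_simple b hi h1 h2]
    simp
  · simp only [reflectionPerm_self_self] at h1 h2
    by_cases h : b.IsPos α
    · exact shift_highest_of_isPos b hθ h h2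
    · have := shift_highest_of_isPos b hθ ((isPos_neg_iff b α).2 h)
        (by rwa [ne_eq, reflectionPerm_self_eq_iff])
      rw [shift_neg] at this
      omega

/-- Since `0 < |ht β| ≤ H`, the number `(H + 1)m - ht β` lies strictly between two consecutive
multiples of `H + 1`, which are determined by `m` and the sign of `β`. -/
theorem height_lt_iff {H : ℤ} {β : ι} (m : ℤ) (h1 : b.height β ≤ H) (h2 : -H ≤ b.height β) :
    ((H + 1) * m - b.height β ≤ 0 ↔ m + negInd b β ≤ 0) ∧
      (-(H + 1) < (H + 1) * m - b.height β ↔ 0 ≤ m + negInd b β) := by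
  by_cases h : b.IsPos β
  · have h0 : 0 < b.height β := h
    rw [negInd_of_pos b h]
    refine ⟨⟨fun h' => ?_, fun h' => ?_⟩, ⟨fun h' => ?_, fun h' => ?_⟩⟩
    · by_contra! hc; nlinarith
    · nlinarith
    · by_contra! hc
      have : m ≤ -1 := by omega
      nlinarith
    · nlinarith
  · have h0 : b.height β < 0 := by
      have := b.height_ne_zero β
      rw [RootPairing.Base.isPos_iff] at h
      omega
    rw [negInd_of_not_pos b h]
    refine ⟨⟨fun h' => ?_, fun h' => ?_⟩, ⟨fun h' => ?_, fun h' => ?_⟩⟩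
    · by_contra! hc
      have : 0 ≤ m := by omega
      nlinarith
    · have : m ≤ -1 := by omega
      nlinarith
    · by_contra! hc
      have : m ≤ -2 := by omega
      nlinarith
    · have : -1 ≤ m := by omega
      nlinarith

/-- Let `λ` be the translation part of `x`. The functional `ψ(v) = (ht θ + 1)⟨λ, x.right v⟩ -
ht(x.right v)` is linear, and `height_lt_iff` turns bounds on shifts into bounds on `ψ`. The
hypothesis at the simple roots gives `ψ ≤ 0` on the positive cone, and at `-θ + δ` it gives `ψ(θ) >
-(ht θ + 1)`. As `θ - α` lies in the cone, `ψ(α)` satisfies both bounds for every positive `α`. -/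
theorem shift_eq_zero_of_simple [P.IsRootSystem] {θ : ι} (hθ : IsHighestRoot b θ) {x : AffWeyl P}
    (hx : ∀ γ ∈ affSimpleRoots b, shift b x γ.1 ≤ 0) (α : ι) : shift b x α = 0 := by
  let C : ℝ := b.height θ + 1
  let ψ : M →+ ℝ := (C • P.toLinearMap.flip ((Multiplicative.toAdd x.left : P.corootSpan ℤ) : N)
    - coordSum b ∅).toAddMonoidHom.comp (DistribSMul.toAddMonoidHom M x.right)
  have hψ : ∀ α, ψ (P.root α) = (((b.height θ + 1) *
      pair (Multiplicative.toAdd x.left) (x.right • α) - b.height (x.right • α) : ℤ) : ℝ) := by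
    intro α
    push_cast
    rw [pair_cast, height_cast b (x.right • α), root_smul]
    rfl
  have hle := fun α => height_lt_iff b (pair (Multiplicative.toAdd x.left) (x.right • α))
    (hθ.height_le (x.right • α)) (hθ.neg_height_le (x.right • α))
  have hcone : ∀ v ∈ AddSubmonoid.closure (P.root '' b.support), ψ v ≤ 0 := by
    intro v hv
    induction hv using AddSubmonoid.closure_induction with
    | mem v hv =>
      obtain ⟨i, hi, rfl⟩ := hv
      have h1 := hx (i, 0) (Or.inl ⟨i, hi, rfl⟩)
      simp only [shift] at h1
      rw [negInd_of_pos b (RootPairing.Base.isPos_of_mem_support hi), sub_zero, ← (hle i).1] at h1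
      rw [hψ]
      exact_mod_cast h1
    | zero => simp
    | add v w _ _ h1 h2 => rw [map_add]; exact add_nonpos h1 h2
  have hθ' : -((b.height θ + 1 : ℤ) : ℝ) < ψ (P.root θ) := by
    have h1 := hx _ (Or.inr ⟨θ, hθ, rfl⟩)
    simp only [shift_neg] at h1
    simp only [shift] at h1
    rw [negInd_of_pos b hθ.isPos, sub_zero, neg_nonpos, ← (hle θ).2] at h1
    rw [hψ]
    exact_mod_cast h1
  have hpos : ∀ α, b.IsPos α → shift b x α = 0 := by
    intro α hα
    have h1 := hcone _ ((isPos_iff_mem_closure b α).1 hα)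
    have h2 := hcone _ (hθ α)
    rw [map_sub] at h2
    have h3 : -((b.height θ + 1 : ℤ) : ℝ) < ψ (P.root α) := by linarith
    rw [hψ] at h1 h3
    have h4 := (hle α).1.1 (by exact_mod_cast h1)
    have h5 := (hle α).2.1 (by exact_mod_cast h3)
    simp only [shift]
    rw [negInd_of_pos b hα]
    omega
  by_cases hα : b.IsPos α
  · exact hpos α hα
  · have := hpos _ ((isPos_neg_iff b α).2 hα)
    rw [shift_neg] at this
    omega

/-! ### Generation by simple affine reflections, and the length formula. -/

variable [Fintype ι] [P.IsReduced]

theorem inversions_fin_eq_zero {w : P.weylGroup} (h : ∀ α, negInd b (w • α) = negInd b α) :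
    w = 1 := by
  refine (finiteSystem b).eq_one_of_L_eq_zero (Finset.sum_eq_zero fun α _ => ?_)
  rw [shift_fin, h, sub_self, Int.natAbs_zero]

/-- Vanishing shifts bound all pairings of the translation part by one, so it is zero; the remaining
element of `W` preserves all signs. -/
theorem eq_one_of_shift_eq_zero {x : AffWeyl P} (h : ∀ α, shift b x α = 0) : x = 1 := by
  have h1 : Multiplicative.toAdd x.left = 0 := by
    refine eq_zero_of_pair_le_one (Ψ := Set.univ) (fun _ _ _ _ => trivial) ?_ fun β _ => ?_
    · rw [Set.image_univ]
      exact (Multiplicative.toAdd x.left).2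
    · have h2 := h (x.right⁻¹ • β)
      simp only [shift, smul_inv_smul] at h2
      have h3 := negInd_nonneg b β
      have h4 := negInd_le_one b (x.right⁻¹ • β)
      omega
  have h2 : x.right = 1 := inversions_fin_eq_zero b fun α => by
    have h3 := h α
    rw [shift, h1, pair, map_zero] at h3
    omega
  exact aff_ext h1 h2

theorem inversions_mul_affRefl [P.IsRootSystem] {γ : AffRoot P} (hγ : γ ∈ affSimpleRoots b)
    {x : AffWeyl P} (hx : shift b x γ.1 ≤ 0) :
    inversions b (x * affRefl γ) = inversions b x + 1 :=
  inversions_mul b (affRefl_right γ) (shift_affRefl_self b γ (snd_of_mem_affSimpleRoots b hγ))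
    (fun _ h1 h2 => shift_affRefl_of_ne b hγ h1 h2) hx

/-- Induction on the number of inversions: a simple affine root with positive shift allows one to be
removed, and if there is none then `x = 1`. -/
theorem affSimpleRefls_closure [P.IsRootSystem] [P.IsIrreducible] :
    Subgroup.closure (affSimpleRefls b) = ⊤ := by
  obtain ⟨θ, hθ⟩ := exists_isHighestRoot b
  rw [eq_top_iff]
  rintro x -
  induction hn : inversions b x using Nat.strong_induction_on generalizing x with
  | _ n ih =>
    by_cases hx : ∀ γ ∈ affSimpleRoots b, shift b x γ.1 ≤ 0
    · rw [eq_one_of_shift_eq_zero b (shift_eq_zero_of_simple b hθ hx)]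
      exact one_mem _
    · push Not at hx
      obtain ⟨γ, hγ, hpos⟩ := hx
      have hx' : x = x * affRefl γ * affRefl γ := by
        rw [mul_assoc, affRefl_mul_self, mul_one]
      have hle : shift b (x * affRefl γ) γ.1 ≤ 0 := by
        rw [shift_mul, shift_affRefl_self b γ (snd_of_mem_affSimpleRoots b hγ), affRefl_right,
          refl_smul, shift_neg]
        omega
      have h1 := inversions_mul_affRefl b hγ hle
      rw [← hx'] at h1
      rw [hx']
      refine mul_mem (ih _ (by omega) rfl) (Subgroup.subset_closure ?_)
      rw [← image_affSimpleRoots]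
      exact ⟨γ, hγ, rfl⟩

/-- The affine Weyl group acting on the affine real roots. -/
def affineSystem [P.IsRootSystem] [P.IsIrreducible] :
    ReflectionSystem (AffWeyl P) (AffRoot P) where
  pos := AffPos b
  neg γ := (P.reflectionPerm γ.1 γ.1, -γ.2)
  refl := affRefl
  Δ := affSimpleRoots b
  L := inversions b
  refl_smul := affRefl_conj
  refl_mul_self := affRefl_mul_self
  refl_neg := affRefl_neg
  pos_neg γ := by
    have := affNeg_iff b γ
    rwa [AffNeg] at this
  smul_neg x γ := by
    simp only [aff_smul_def, affAct, smul_reflectionPerm_self, pair_neg_root]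
    congr 1
    ring
  refl_smul_self γ := by
    have h := affRefl_right γ
    simp only [aff_smul_def, affAct, affRefl_left, h, refl_smul, pair_neg_root]
    rw [pair, map_neg, ← pair, pair_zsmul_coroot, P.pairingIn_same]
    congr 1
    ring
  pos_of_mem γ hγ := by
    rw [affPos_iff, snd_of_mem_affSimpleRoots b hγ]
  eq_of_not_pos := by
    intro γ hγ β hβ h
    have h0 := snd_of_mem_affSimpleRoots b hγ
    rw [aff_smul_def, affPos_affAct_iff] at h
    rw [affPos_iff] at hβ
    by_cases h1 : β.1 = γ.1
    · rw [h1, shift_affRefl_self b γ h0] at h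
      rw [h1] at hβ
      exact Prod.ext h1 (by omega)
    exfalso
    by_cases h2 : β.1 = P.reflectionPerm γ.1 γ.1
    · rw [h2, shift_neg, shift_affRefl_self b γ h0] at h
      rw [h2] at hβ
      omega
    · rw [shift_affRefl_of_ne b hγ h1 h2] at h
      omega
  closure_eq_top := by
    rw [image_affSimpleRoots]
    exact affSimpleRefls_closure b
  L_one := by
    simp [inversions, shift]
  L_mul := by
    intro γ hγ x hx
    rw [aff_smul_def, affPos_affAct_iff, snd_of_mem_affSimpleRoots b hγ] at hx
    exact inversions_mul_affRefl b hγ (by omega)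

theorem len_eq (w : P.weylGroup) : len b w = inversions b (fin w) :=
  (finiteSystem b).wl_eq_L w

theorem cover_iff (u v : P.weylGroup) :
    Cover b u v ↔ ∃ α, v = u * refl P α ∧ len b v = len b u + 1 :=
  (finiteSystem b).cover_iff

theorem affCover_iff [P.IsRootSystem] [P.IsIrreducible] (x y : AffWeyl P) :
    AffCover b x y ↔ ∃ γ, y = x * affRefl γ ∧ inversions b y = inversions b x + 1 := by
  have h := (affineSystem b).cover_iff (u := x) (v := y)
  rw [(affineSystem b).wl_eq_L, (affineSystem b).wl_eq_L] at h
  rw [AffCover, ← image_affSimpleRoots]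
  exact h

end AffineSystem

/-! ### Parabolic subgroups and lengths -/

section Parabolic

variable [Fintype ι] [P.IsRootSystem] [P.IsCrystallographic] (b : P.Base) {J : Finset ι}

open Classical in
/-- The positive roots outside `Φ_J`. -/
def offJ (b : P.Base) (J : Finset ι) : Finset ι :=
  Finset.univ.filter fun α => 0 < coordSum b J (P.root α)

open Classical in
/-- The positive roots in `Φ_J`. -/
def posJ (b : P.Base) (J : Finset ι) : Finset ι :=
  Finset.univ.filter fun α => b.IsPos α ∧ α ∈ rootsJ P J

theorem mem_offJ_iff {α : ι} : α ∈ offJ b J ↔ 0 < coordSum b J (P.root α) := by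
  simp [offJ]

theorem mem_offJ (hJ : J ⊆ b.support) {α : ι} : α ∈ offJ b J ↔ b.IsPos α ∧ α ∉ rootsJ P J := by
  rw [mem_offJ_iff, isPos_and_notMem_iff b hJ]

theorem smul_mem_offJ (hJ : J ⊆ b.support) {u : P.weylGroup} (hu : u ∈ parabolic P J) {α : ι} :
    u • α ∈ offJ b J ↔ α ∈ offJ b J := by
  rw [mem_offJ_iff, mem_offJ_iff, root_smul, coordSum_smul b hJ hu]

theorem mem_rootsJ_of_mem {j : ι} (hj : j ∈ J) : j ∈ rootsJ P J :=
  Submodule.subset_span ⟨j, hj, rfl⟩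

open Classical in
theorem sum_pos_eq (hJ : J ⊆ b.support) (f : ι → ℤ) :
    ∑ α with b.IsPos α, f α = ∑ α ∈ offJ b J, f α + ∑ α ∈ posJ b J, f α := by
  rw [← Finset.sum_filter_not_add_sum_filter _ (· ∈ rootsJ P J) f]
  congr 1 <;> refine Finset.sum_congr (Finset.ext fun α => ?_) fun _ _ => rfl
  · simp [mem_offJ b hJ]
  · simp [posJ]

theorem sum_offJ_smul (hJ : J ⊆ b.support) {u : P.weylGroup} (hu : u ∈ parabolic P J)
    (f : ι → ℤ) : ∑ α ∈ offJ b J, f (u • α) = ∑ α ∈ offJ b J, f α :=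
  Finset.sum_bij' (fun α _ => u • α) (fun α _ => u⁻¹ • α)
    (fun _ h => (smul_mem_offJ b hJ hu).2 h)
    (fun _ h => (smul_mem_offJ b hJ (inv_mem hu)).2 h)
    (fun _ _ => inv_smul_smul _ _) (fun _ _ => smul_inv_smul _ _) (fun _ _ => rfl)

theorem rhoPairing_eq_sum (hJ : J ⊆ b.support) (α : ι) :
    rhoPairing b J α = ∑ β ∈ offJ b J, P.pairingIn ℤ β α := by
  classical
  rw [rhoPairing, sum_pos_eq b hJ, sub_eq_iff_eq_add]
  congr 1

theorem notMem_rootsJ_empty (α : ι) : α ∉ rootsJ P (∅ : Finset ι) := by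
  simp [rootsJ, P.ne_zero α]

theorem rhoPairing_empty (hJ : J ⊆ b.support) (α : ι) :
    rhoPairing b ∅ α = rhoPairing b J α + ∑ β ∈ posJ b J, P.pairingIn ℤ β α := by
  classical
  rw [rhoPairing_eq_sum b hJ, ← sum_pos_eq b hJ, rhoPairing, sub_eq_self]
  exact Finset.sum_eq_zero fun β hβ => absurd (Finset.mem_filter.1 hβ).2.2 (notMem_rootsJ_empty β)

theorem rhoPairing_smul (hJ : J ⊆ b.support) {u : P.weylGroup} (hu : u ∈ parabolic P J) (α : ι) :
    rhoPairing b J (u • α) = rhoPairing b J α := by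
  rw [rhoPairing_eq_sum b hJ, rhoPairing_eq_sum b hJ, ← sum_offJ_smul b hJ hu]
  exact Finset.sum_congr rfl fun β _ => pairingIn_smul u β α

variable [P.IsReduced]

open Classical in
theorem len_eq_sum (w : P.weylGroup) :
    (len b w : ℤ) = ∑ α with b.IsPos α, negInd b (w • α) := by
  rw [len_eq, inversions, Nat.cast_sum]
  refine Finset.sum_congr rfl fun α hα => ?_
  rw [shift_fin, negInd_of_pos b (Finset.mem_filter.1 hα).2, sub_zero,
    Int.natAbs_of_nonneg (negInd_nonneg b _)]

theorem negInd_eq_of_isPos {w : P.weylGroup}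
    (h : ∀ α, b.IsPos α → α ∈ rootsJ P J → b.IsPos (w • α)) {α : ι} (hα : α ∈ rootsJ P J) :
    negInd b (w • α) = negInd b α := by
  by_cases hpos : b.IsPos α
  · rw [negInd_of_pos b hpos, negInd_of_pos b (h α hpos hα)]
  · have := h _ ((isPos_neg_iff b α).2 hpos) ((neg_mem_rootsJ _).2 hα)
    rw [smul_reflectionPerm_self, isPos_neg_iff] at this
    rw [negInd_of_not_pos b hpos, negInd_of_not_pos b this]

/-- A vector of the positive cone on which `coordSum b J` vanishes is a sum of simple roots in `J`
only, so `w` gives it nonnegative height. -/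
theorem negInd_eq_of_simple {w : P.weylGroup} (hJ : J ⊆ b.support)
    (h : ∀ j ∈ J, b.IsPos (w • j)) {α : ι} (hα : α ∈ rootsJ P J) :
    negInd b (w • α) = negInd b α := by
  classical
  refine negInd_eq_of_isPos b (fun α hpos hα => ?_) hα
  have key : ∀ x ∈ AddSubmonoid.closure (P.root '' b.support), coordSum b J x = 0 →
      0 ≤ coordSum b ∅ (w • x) := by
    intro x hx h0
    induction hx using AddSubmonoid.closure_induction with
    | mem x hx =>
      obtain ⟨i, hi, rfl⟩ := hx
      rw [coordSum_simple b J hi] at h0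
      split_ifs at h0 with hiJ
      · rw [← root_smul]
        exact ((isPos_iff_coordSum b _).1 (h i hiJ)).le
      · norm_num at h0
    | zero => simp
    | add x y hx hy ihx ihy =>
      rw [map_add] at h0
      have h1 := coordSum_nonneg b J hx
      have h2 := coordSum_nonneg b J hy
      rw [smul_add, map_add]
      exact add_nonneg (ihx (by linarith)) (ihy (by linarith))
  have h1 := key _ ((isPos_iff_mem_closure b α).1 hpos) ((mem_rootsJ_iff b hJ α).1 hα)
  rw [← root_smul, ← height_cast] at h1
  rw [RootPairing.Base.isPos_iff']
  exact_mod_cast h1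

theorem len_eq_sum_offJ (hJ : J ⊆ b.support) {w : P.weylGroup}
    (hw : ∀ α ∈ rootsJ P J, negInd b (w • α) = negInd b α) :
    (len b w : ℤ) = ∑ α ∈ offJ b J, negInd b (w • α) := by
  classical
  rw [len_eq_sum, sum_pos_eq b hJ, add_eq_left]
  refine Finset.sum_eq_zero fun α hα => ?_
  have hα := (Finset.mem_filter.1 hα).2
  rw [hw α hα.2, negInd_of_pos b hα.1]

theorem isPos_smul_of_mem_offJ (hJ : J ⊆ b.support) {u : P.weylGroup} (hu : u ∈ parabolic P J)
    {α : ι} (hα : α ∈ offJ b J) : b.IsPos (u • α) :=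
  ((mem_offJ b hJ).1 ((smul_mem_offJ b hJ hu).2 hα)).1

theorem len_eq_sum_posJ (hJ : J ⊆ b.support) {u : P.weylGroup} (hu : u ∈ parabolic P J) :
    (len b u : ℤ) = ∑ α ∈ posJ b J, negInd b (u • α) := by
  classical
  rw [len_eq_sum, sum_pos_eq b hJ, add_eq_right]
  exact Finset.sum_eq_zero fun α hα => negInd_of_pos b (isPos_smul_of_mem_offJ b hJ hu hα)

/-- Since `u` permutes the positive roots outside `Φ_J`, these contribute `ℓ(w)`; the roots in `Φ_J`
keep their sign under `w` and contribute `ℓ(u)`. -/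
theorem len_mul (hJ : J ⊆ b.support) {w u : P.weylGroup}
    (hw : ∀ α ∈ rootsJ P J, negInd b (w • α) = negInd b α) (hu : u ∈ parabolic P J) :
    len b (w * u) = len b w + len b u := by
  classical
  have h : (len b (w * u) : ℤ) = len b w + len b u := by
    rw [len_eq_sum, sum_pos_eq b hJ, len_eq_sum_offJ b hJ hw, len_eq_sum_posJ b hJ hu,
      ← sum_offJ_smul b hJ hu fun α => negInd b (w • α)]
    congr 1
    refine Finset.sum_congr rfl fun α hα => ?_
    have hα := (Finset.mem_filter.1 hα).2
    rw [mul_smul, hw _ ((smul_mem_rootsJ b hJ hu α).2 hα.2)]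
  exact_mod_cast h

theorem len_lt_len_mul_refl {w : P.weylGroup} {α : ι} (hα : b.IsPos α) (h : b.IsPos (w • α)) :
    len b w < len b (w * refl P α) :=
  (finiteSystem b).lt_wl_mul_refl hα h

theorem len_mul_refl_lt {w : P.weylGroup} {α : ι} (hα : b.IsPos α) (h : ¬ b.IsPos (w • α)) :
    len b (w * refl P α) < len b w :=
  (finiteSystem b).wl_mul_refl_lt hα h

theorem mem_minReps_iff (hJ : J ⊆ b.support) {w : P.weylGroup} :
    w ∈ minReps b J ↔ ∀ α ∈ rootsJ P J, negInd b (w • α) = negInd b α := by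
  constructor
  · intro hw α hα
    refine negInd_eq_of_simple b hJ (fun j hj => ?_) hα
    by_contra h
    have h1 := hw (refl P j) (Subgroup.subset_closure ⟨j, hj, rfl⟩)
    have h2 := len_mul_refl_lt b (RootPairing.Base.isPos_of_mem_support (hJ hj)) h
    omega
  · intro hw u hu
    rw [len_mul b hJ hw hu]
    omega

theorem eq_one_of_mem_parabolic (hJ : J ⊆ b.support) {u : P.weylGroup} (hu : u ∈ parabolic P J)
    (h : ∀ α ∈ rootsJ P J, negInd b (u • α) = negInd b α) : u = 1 := by
  refine inversions_fin_eq_zero b fun α => ?_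
  have key : ∀ α, α ∉ rootsJ P J → b.IsPos α → negInd b (u • α) = negInd b α := by
    intro α hα hpos
    rw [negInd_of_pos b hpos, negInd_of_pos b]
    exact isPos_smul_of_mem_offJ b hJ hu ((mem_offJ b hJ).2 ⟨hpos, hα⟩)
  by_cases hα : α ∈ rootsJ P J
  · exact h α hα
  by_cases hpos : b.IsPos α
  · exact key α hα hpos
  · have := key _ (fun h' => hα ((neg_mem_rootsJ _).1 h')) ((isPos_neg_iff b α).2 hpos)
    rw [smul_reflectionPerm_self, negInd_neg, negInd_neg] at this
    omega

theorem minReps_unique (hJ : J ⊆ b.support) {v w : P.weylGroup} (hv : v ∈ minReps b J)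
    (hw : w ∈ minReps b J) (h : v⁻¹ * w ∈ parabolic P J) : v = w := by
  rw [mem_minReps_iff b hJ] at hv hw
  have h1 : v⁻¹ * w = 1 := by
    refine eq_one_of_mem_parabolic b hJ h fun α hα => ?_
    rw [← hv _ ((smul_mem_rootsJ b hJ h α).2 hα), smul_smul, mul_inv_cancel_left, hw α hα]
  exact inv_mul_eq_one.1 h1

theorem floor_mem (v : P.weylGroup) : floor b J v ∈ minReps b J :=
  (exists_minRep b J v).choose_spec.1

theorem inv_mul_floor_mem (v : P.weylGroup) : v⁻¹ * floor b J v ∈ parabolic P J :=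
  (exists_minRep b J v).choose_spec.2

theorem floor_inv_mul_mem (v : P.weylGroup) : (floor b J v)⁻¹ * v ∈ parabolic P J := by
  have := inv_mem (inv_mul_floor_mem (J := J) b v)
  rwa [mul_inv_rev, inv_inv] at this

theorem floor_eq (hJ : J ⊆ b.support) {v w : P.weylGroup} (hw : w ∈ minReps b J)
    (h : v⁻¹ * w ∈ parabolic P J) : floor b J v = w := by
  refine minReps_unique b hJ (floor_mem b v) hw ?_
  have := mul_mem (floor_inv_mul_mem (J := J) b v) h
  rwa [mul_assoc, mul_inv_cancel_left] at this

theorem floor_empty (v : P.weylGroup) : floor b ∅ v = v := by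
  have := inv_mul_floor_mem (J := ∅) b v
  rw [parabolic, Finset.coe_empty, Set.image_empty, Subgroup.closure_empty,
    Subgroup.mem_bot] at this
  exact (inv_mul_eq_one.1 this).symm

theorem mem_minReps_empty (v : P.weylGroup) : v ∈ minReps b ∅ := by
  rw [← floor_empty b v]
  exact floor_mem b v

/-! ### Reflecting the positive roots outside `Φ_J` -/

open Classical in
/-- The positive roots outside `Φ_J` which the reflection in `α` does not map to such roots. -/
def crossing (b : P.Base) (J : Finset ι) (α : ι) : Finset ι :=
  (offJ b J).filter fun β => refl P α • β ∉ offJ b J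

/-- The roots that `r_α` keeps in the set cancel in pairs, a fixed root contributing zero. The lemma
applies both to length differences and to `⟨α^∨, 2ρ - 2ρ_J⟩`, so that the two can be compared term
by term. -/
theorem sum_offJ_eq_sum_crossing {α : ι} {f : ι → ℤ} (hf : ∀ β, f (refl P α • β) = - f β) :
    ∑ β ∈ offJ b J, f β = ∑ β ∈ crossing b J α, f β := by
  classical
  rw [← Finset.sum_filter_not_add_sum_filter _ (fun β => refl P α • β ∉ offJ b J) f]
  refine (add_eq_right.2 ?_)
  refine Finset.sum_involution (fun β _ => refl P α • β) ?_ ?_ ?_ ?_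
  · intro β _; rw [hf, add_neg_cancel]
  · intro β _ hne heq
    have := hf β
    rw [heq] at this
    omega
  · intro β hβ
    simp only [Finset.mem_filter, not_not, refl_smul_refl_smul] at hβ ⊢
    exact ⟨hβ.2, hβ.1⟩
  · intro β _; exact refl_smul_refl_smul α β

theorem coordSum_refl_smul (α β : ι) : coordSum b J (P.root (refl P α • β)) =
    coordSum b J (P.root β) - P.pairingIn ℤ β α * coordSum b J (P.root α) := by
  rw [root_refl_smul, map_sub, map_zsmul, zsmul_eq_mul]

theorem one_le_pairingIn_of_mem_crossing {α β : ι} (hα : α ∈ offJ b J)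
    (hβ : β ∈ crossing b J α) : 1 ≤ P.pairingIn ℤ β α := by
  classical
  obtain ⟨h1, h2⟩ := Finset.mem_filter.1 hβ
  rw [mem_offJ_iff] at h1 h2 hα
  rw [coordSum_refl_smul] at h2
  by_contra! h
  have h3 : (P.pairingIn ℤ β α : ℝ) ≤ 0 := by exact_mod_cast Int.lt_add_one_iff.1 h
  nlinarith

theorem self_mem_crossing {α : ι} (hα : α ∈ offJ b J) : α ∈ crossing b J α := by
  classical
  refine Finset.mem_filter.2 ⟨hα, ?_⟩
  rw [mem_offJ_iff] at hα ⊢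
  rw [refl_smul, root_reflectionPerm_self, map_neg]
  linarith

theorem pairingIn_refl_smul (α β : ι) :
    P.pairingIn ℤ (refl P α • β) α = - P.pairingIn ℤ β α := by
  have h := pairingIn_smul (refl P α) (refl P α • β) α
  rw [refl_smul_refl_smul, refl_smul (P := P) α α, P.pairingIn_reflectionPerm_self_right] at h
  exact h.symm

theorem negInd_sub_refl (w : P.weylGroup) (α β : ι) :
    negInd b (w • refl P α • β) - negInd b ((w * refl P α) • refl P α • β) =
      -(negInd b (w • β) - negInd b ((w * refl P α) • β)) := by
  rw [mul_smul, mul_smul, refl_smul_refl_smul]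
  ring

/-- Passing from `w r_α` to its minimal representative changes it by an element of `W_J`, which only
permutes the summands. -/
theorem len_sub_len_floor (hJ : J ⊆ b.support) {w : P.weylGroup} (hw : w ∈ minReps b J) (α : ι) :
    (len b w : ℤ) - len b (floor b J (w * refl P α)) =
      ∑ β ∈ crossing b J α, (negInd b (w • β) - negInd b ((w * refl P α) • β)) := by
  rw [len_eq_sum_offJ b hJ ((mem_minReps_iff b hJ).1 hw),
    len_eq_sum_offJ b hJ ((mem_minReps_iff b hJ).1 (floor_mem b _)),
    ← sum_offJ_smul b hJ (floor_inv_mul_mem (J := J) b (w * refl P α))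
      fun β => negInd b (floor b J (w * refl P α) • β),
    ← Finset.sum_sub_distrib, ← sum_offJ_eq_sum_crossing b (negInd_sub_refl b w α)]
  refine Finset.sum_congr rfl fun β _ => ?_
  rw [smul_smul, mul_inv_cancel_left]

theorem rhoPairing_eq_sum_crossing (hJ : J ⊆ b.support) (α : ι) :
    rhoPairing b J α = ∑ β ∈ crossing b J α, P.pairingIn ℤ β α := by
  rw [rhoPairing_eq_sum b hJ, sum_offJ_eq_sum_crossing b (pairingIn_refl_smul α)]

theorem two_le_rhoPairing (hJ : J ⊆ b.support) {α : ι} (hα : α ∈ offJ b J) :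
    2 ≤ rhoPairing b J α := by
  rw [rhoPairing_eq_sum_crossing b hJ]
  refine le_trans ?_ (Finset.single_le_sum (fun β hβ =>
    zero_le_one.trans (one_le_pairingIn_of_mem_crossing b hα hβ)) (self_mem_crossing b hα))
  rw [P.pairingIn_same]

/-- On each crossing root the sign change is at most one in absolute value and the pairing is at
least one; at `α` itself the pairing is two, whence strictness. -/
theorem abs_len_sub_len_floor_lt (hJ : J ⊆ b.support) {w : P.weylGroup} (hw : w ∈ minReps b J)
    {α : ι} (hα : α ∈ offJ b J) :
    |(len b w : ℤ) - len b (floor b J (w * refl P α))| < rhoPairing b J α := by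
  rw [len_sub_len_floor b hJ hw, rhoPairing_eq_sum_crossing b hJ]
  refine (Finset.abs_sum_le_sum_abs _ _).trans_lt (Finset.sum_lt_sum (fun β hβ => ?_)
    ⟨α, self_mem_crossing b hα, ?_⟩)
  · have h1 := one_le_pairingIn_of_mem_crossing b hα hβ
    have h2 := negInd_nonneg b (w • β)
    have h3 := negInd_le_one b (w • β)
    have h4 := negInd_nonneg b ((w * refl P α) • β)
    have h5 := negInd_le_one b ((w * refl P α) • β)
    rw [abs_le]
    omega
  · have h2 := negInd_nonneg b (w • α)
    have h3 := negInd_le_one b (w • α)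
    have h4 := negInd_nonneg b ((w * refl P α) • α)
    have h5 := negInd_le_one b ((w * refl P α) • α)
    rw [P.pairingIn_same, abs_lt]
    omega

/-- For a quantum edge all inequalities in the length estimate are equalities. -/
theorem pairingIn_of_quantum (hJ : J ⊆ b.support) {w : P.weylGroup} (hw : w ∈ minReps b J)
    {α : ι} (hα : α ∈ offJ b J)
    (h : (len b (floor b J (w * refl P α)) : ℤ) = len b w + 1 - rhoPairing b J α) {β : ι}
    (hβ : β ∈ rootsJ P J) :
    P.pairingIn ℤ β α = negInd b β - negInd b ((w * refl P α) • β) := by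
  classical
  have hle : ∀ β ∈ crossing b J α,
      0 ≤ P.pairingIn ℤ β α - (negInd b (w • β) - negInd b ((w * refl P α) • β)) := by
    intro β hβ
    have h1 := one_le_pairingIn_of_mem_crossing b hα hβ
    have h3 := negInd_le_one b (w • β)
    have h4 := negInd_nonneg b ((w * refl P α) • β)
    omega
  -- The terms are nonnegative integers with sum one, and the term at `α` is already at least one,
  -- so all others vanish.
  have hsum : ∑ β ∈ crossing b J α,
      (P.pairingIn ℤ β α - (negInd b (w • β) - negInd b ((w * refl P α) • β))) = 1 := by
    rw [Finset.sum_sub_distrib, ← len_sub_len_floor b hJ hw, ← rhoPairing_eq_sum_crossing b hJ]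
    omega
  have hcross : ∀ γ ∈ crossing b J α, γ ≠ α →
      P.pairingIn ℤ γ α = 1 ∧ negInd b ((w * refl P α) • γ) = 0 ∧ negInd b (w • γ) = 1 := by
    intro γ hγ hne
    have h0 : P.pairingIn ℤ α α - (negInd b (w • α) - negInd b ((w * refl P α) • α)) +
        (P.pairingIn ℤ γ α - (negInd b (w • γ) - negInd b ((w * refl P α) • γ))) ≤ 1 := by
      rw [← hsum, ← Finset.sum_pair (f := fun β =>
        P.pairingIn ℤ β α - (negInd b (w • β) - negInd b ((w * refl P α) • β))) hne.symm]
      refine Finset.sum_le_sum_of_subset_of_nonneg ?_ fun β hβ _ => hle β hβ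
      intro δ hδ
      rcases Finset.mem_insert.1 hδ with rfl | hδ
      · exact self_mem_crossing b hα
      · rwa [Finset.mem_singleton.1 hδ]
    have h1 := one_le_pairingIn_of_mem_crossing b hα hγ
    have h2 := negInd_le_one b (w • α)
    have h3 := negInd_nonneg b ((w * refl P α) • α)
    have h4 := negInd_le_one b (w • γ)
    have h5 := negInd_nonneg b ((w * refl P α) • γ)
    rw [P.pairingIn_same] at h0
    omega
  have hα' := (mem_offJ_iff b).1 hα
  have key : ∀ β ∈ rootsJ P J, P.pairingIn ℤ β α < 0 →
      P.pairingIn ℤ β α = negInd b β - negInd b ((w * refl P α) • β) := by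
    intro β hβ hneg
    have hβ0 := (mem_rootsJ_iff b hJ β).1 hβ
    have hmem : refl P α • β ∈ offJ b J := by
      rw [mem_offJ_iff, coordSum_refl_smul, hβ0]
      have : (P.pairingIn ℤ β α : ℝ) < 0 := by exact_mod_cast hneg
      nlinarith
    -- When `⟨β, α^∨⟩ < 0`, the root `r_α β` lies outside `Φ_J` and is sent back into `Φ_J`. It is
    -- therefore crossing, and its pairing and signs are known.
    have hc : refl P α • β ∈ crossing b J α := by
      refine Finset.mem_filter.2 ⟨hmem, ?_⟩
      rw [refl_smul_refl_smul, mem_offJ_iff, hβ0]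
      exact lt_irrefl _
    have hne : refl P α • β ≠ α := by
      intro h
      have h1 : β = P.reflectionPerm α α := by
        rw [← refl_smul_refl_smul (P := P) α β, h, refl_smul]
      rw [h1, neg_mem_rootsJ] at hβ
      exact ((mem_offJ b hJ).1 hα).2 hβ
    obtain ⟨h1, h2, h3⟩ := hcross _ hc hne
    rw [pairingIn_refl_smul] at h1
    rw [mul_smul, refl_smul_refl_smul, (mem_minReps_iff b hJ).1 hw β hβ] at h2
    rw [mul_smul, h3, h2]
    omega
  rcases lt_trichotomy (P.pairingIn ℤ β α) 0 with h1 | h1 | h1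
  · exact key β hβ h1
  · have h2 : refl P α • β = β := P.root.injective (by
      rw [root_refl_smul, h1, zero_smul, sub_zero])
    rw [h1, mul_smul, h2, (mem_minReps_iff b hJ).1 hw β hβ, sub_self]
  · have h2 := key (P.reflectionPerm β β) ((neg_mem_rootsJ _).2 hβ) (by
      rw [P.pairingIn_reflectionPerm_self_left]; omega)
    rw [P.pairingIn_reflectionPerm_self_left, smul_reflectionPerm_self, negInd_neg,
      negInd_neg] at h2
    omega

/-- If `w r_α` sent a simple root `j ∈ J` to a negative root, then `ℓ(w r_α r_j) ≤ ℓ(w)`. But `w r_α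
r_j = w r_j r_{r_j α}`, and both of these right multiplications increase the length. -/
theorem mul_refl_mem_minReps (hJ : J ⊆ b.support) {w : P.weylGroup} (hw : w ∈ minReps b J)
    {α : ι} (hα : α ∈ offJ b J) (h : len b (w * refl P α) = len b w + 1) :
    w * refl P α ∈ minReps b J := by
  rw [mem_minReps_iff b hJ] at hw ⊢
  obtain ⟨hpos, hαJ⟩ := (mem_offJ b hJ).1 hα
  have hwα : b.IsPos (w • α) := by
    by_contra h'
    have := len_mul_refl_lt b hpos h'
    omega
  intro β hβ
  refine negInd_eq_of_simple b hJ (fun j hj => ?_) hβ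
  by_contra hneg
  have hjpos := RootPairing.Base.isPos_of_mem_support (hJ hj)
  have hjJ : j ∈ rootsJ P J := mem_rootsJ_of_mem hj
  have h1 := len_mul_refl_lt b hjpos hneg
  have h2 : len b w < len b (w * refl P j) := by
    refine len_lt_len_mul_refl b hjpos ?_
    rw [← negInd_eq_zero_iff b, hw j hjJ, negInd_of_pos b hjpos]
  have h3 : len b (w * refl P j) < len b (w * refl P j * refl P (refl P j • α)) := by
    refine len_lt_len_mul_refl b (hpos.reflectionPerm (hJ hj) ?_) ?_
    · rintro rfl; exact hαJ hjJ
    · rwa [mul_smul, refl_smul_refl_smul]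
  have h4 : w * refl P j * refl P (refl P j • α) = w * refl P α * refl P j := by
    rw [refl_conj, refl_inv]
    simp only [mul_assoc]
    rw [← mul_assoc (refl P j) (refl P j), refl_mul_self, one_mul]
  rw [h4] at h3
  omega

end Parabolic

/-! ### Projections of translations -/

section Projection

theorem latticeEquiv_mul (v w : P.weylGroup) (μ : P.corootSpan ℤ) :
    latticeEquiv (v * w) μ = latticeEquiv v (latticeEquiv w μ) :=
  Subtype.ext (corootMap_mul v w μ)

theorem latticeEquiv_one (μ : P.corootSpan ℤ) : latticeEquiv (1 : P.weylGroup) μ = μ :=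
  Subtype.ext (corootMap_one _)

theorem toAdd_left_fin_mul_transl (w : P.weylGroup) (μ : P.corootSpan ℤ) :
    Multiplicative.toAdd (fin w * transl μ).left = latticeEquiv w μ := by
  rw [toAdd_left_mul]
  simp

theorem right_fin_mul_transl (w : P.weylGroup) (μ : P.corootSpan ℤ) :
    (fin w * transl μ).right = w := by
  simp

theorem fin_mul (v w : P.weylGroup) : (fin (v * w) : AffWeyl P) = fin v * fin w := map_mul _ _ _

theorem transl_mul_fin (w : P.weylGroup) (μ : P.corootSpan ℤ) :
    transl μ * fin w = fin w * transl (latticeEquiv w⁻¹ μ) := by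
  apply aff_ext
  · rw [toAdd_left_fin_mul_transl, ← latticeEquiv_mul, mul_inv_cancel, latticeEquiv_one,
      toAdd_left_mul]
    simp
  · simp

theorem transl_mul_transl (μ ν : P.corootSpan ℤ) :
    (transl μ * transl ν : AffWeyl P) = transl (μ + ν) := by
  rw [transl, transl, transl, ofAdd_add, map_mul]

theorem fin_mul_transl_inj {v w : P.weylGroup} {μ ν : P.corootSpan ℤ}
    (h : (fin v * transl μ : AffWeyl P) = fin w * transl ν) : v = w ∧ μ = ν := by
  have h1 := congrArg SemidirectProduct.right h
  have h2 := congrArg (fun x : AffWeyl P => Multiplicative.toAdd x.left) h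
  simp only [toAdd_left_fin_mul_transl, right_fin_mul_transl] at h1 h2
  subst h1
  exact ⟨rfl, (latticeEquiv v).injective h2⟩

variable [P.IsCrystallographic]

theorem sub_latticeEquiv_mem {J : Finset ι} {u : P.weylGroup} (hu : u ∈ parabolic P J)
    (μ : P.corootSpan ℤ) :
    ((μ - latticeEquiv u μ : P.corootSpan ℤ) : N) ∈ Submodule.span ℤ (P.coroot '' J) := by
  induction hu using Subgroup.closure_induction generalizing μ with
  | mem u hu =>
    obtain ⟨j, hj, rfl⟩ := hu
    rw [latticeEquiv_refl, sub_sub_cancel]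
    exact Submodule.smul_mem _ _ (Submodule.subset_span ⟨j, hj, rfl⟩)
  | one => rw [latticeEquiv_one, sub_self]; exact zero_mem _
  | mul u v _ _ hu hv =>
    rw [latticeEquiv_mul, ← sub_add_sub_cancel μ (latticeEquiv v μ)]
    exact add_mem (hv μ) (hu _)
  | inv u _ hu =>
    have h := hu (latticeEquiv u⁻¹ μ)
    rw [← latticeEquiv_mul, mul_inv_cancel, latticeEquiv_one] at h
    rw [← neg_sub]
    exact neg_mem h

theorem transl_mul_affRefl (μ : P.corootSpan ℤ) (γ : AffRoot P) :
    transl μ * affRefl γ =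
      fin (refl P γ.1) * transl (μ + (γ.2 - pair μ γ.1) • P.corootSpanMem ℤ γ.1) := by
  apply aff_ext
  · rw [toAdd_left_fin_mul_transl, toAdd_left_mul, affRefl_left, SemidirectProduct.right_inl,
      latticeEquiv_one, map_add, map_zsmul, latticeEquiv_coroot, latticeEquiv_refl, refl_smul,
      P.corootSpanMem_reflectionPerm_self]
    simp only [SemidirectProduct.left_inl, toAdd_ofAdd]
    module
  · rw [right_fin_mul_transl, SemidirectProduct.mul_right, affRefl_right,
      SemidirectProduct.right_inl, one_mul]

variable (b : P.Base) {J : Finset ι}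

/-- Testing on the lowest positive affine root with classical part `α` bounds the shift from above,
and the same for `-α` bounds it from below. -/
theorem mem_affMinReps_iff (x : AffWeyl P) :
    x ∈ affMinReps b J ↔ ∀ α ∈ rootsJ P J, shift b x α = 0 := by
  constructor
  · intro hx
    have key : ∀ α ∈ rootsJ P J, shift b x α ≤ 0 := by
      intro α hα
      have h := hx (α, negInd b α) ((affPos_iff b _).2 le_rfl) hα
      rw [affPos_affAct_iff] at h
      simp only at h
      omega
    intro α hα
    have h1 := key α hα
    have h2 := key _ ((neg_mem_rootsJ α).2 hα)
    rw [shift_neg] at h2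
    omega
  · intro h β hβ hβJ
    rw [affPos_affAct_iff, h _ hβJ, zero_add]
    exact (affPos_iff b β).1 hβ

variable [P.IsRootSystem] [Fintype ι] [P.IsReduced]

theorem isProj_iff (z : P.weylGroup) (μ : P.corootSpan ℤ) :
    IsProj b J (transl μ) (fin z * transl μ) ↔
      z ∈ parabolic P J ∧ ∀ α ∈ rootsJ P J, pair μ α = negInd b α - negInd b (z • α) := by
  have h0 : fin z * transl μ ∈ affMinReps b J ↔
      ∀ α ∈ rootsJ P J, pair μ α = negInd b α - negInd b (z • α) := by
    rw [mem_affMinReps_iff]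
    refine forall₂_congr fun α _ => ?_
    rw [shift_fin_mul_transl]
    omega
  rw [IsProj, h0, and_comm]
  refine and_congr_left fun _ => ⟨?_, fun hz => ?_⟩
  · rintro ⟨_, ⟨u, hu, ν, -, rfl⟩, h⟩
    have h1 := congrArg SemidirectProduct.right h
    simp only [SemidirectProduct.mul_right, SemidirectProduct.right_inl,
      SemidirectProduct.right_inr, mul_one] at h1
    rw [eq_inv_of_mul_eq_one_left h1.symm]
    exact inv_mem hu
  -- The factorization is `t_μ = (z t_μ)(z⁻¹ t_{μ - zμ})`, where `μ - zμ ∈ Q_J^∨` because `z ∈ W_J`.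
  · refine ⟨_, ⟨z⁻¹, inv_mem hz, μ - latticeEquiv z μ, sub_latticeEquiv_mem hz μ, rfl⟩, ?_⟩
    rw [← mul_assoc, mul_assoc (fin z), transl_mul_fin, inv_inv, ← mul_assoc, ← fin_mul,
      mul_inv_cancel, mul_assoc, transl_mul_transl, add_sub_cancel,
      show (fin 1 : AffWeyl P) = 1 from map_one _, one_mul]

/-- The translation parts of two projections differ by a vector of `Q_J^∨` whose pairings with `Φ_J`
are at most one, hence by zero. The finite parts then have the same signs on `Φ_J` and agree. -/
theorem isProj_unique (hJ : J ⊆ b.support) {z : P.weylGroup} {μ : P.corootSpan ℤ}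
    {p : AffWeyl P} (hz : IsProj b J (transl μ) (fin z * transl μ))
    (hp : IsProj b J (transl μ) p) : p = fin z * transl μ := by
  obtain ⟨hzJ, hzμ⟩ := (isProj_iff b z μ).1 hz
  obtain ⟨hmin, _, ⟨a, ha, ν, hν, rfl⟩, h⟩ := hp
  rw [mem_affMinReps_iff] at hmin
  have h1 := congrArg SemidirectProduct.right h
  simp only [SemidirectProduct.mul_right, SemidirectProduct.right_inl,
    SemidirectProduct.right_inr, mul_one] at h1
  have h1 : p.right = a⁻¹ := eq_inv_of_mul_eq_one_left h1.symm
  have h2 := congrArg (fun x : AffWeyl P => Multiplicative.toAdd x.left) h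
  simp only [toAdd_left_mul p, toAdd_left_fin_mul_transl, h1, ← latticeEquiv_mul,
    inv_mul_cancel, latticeEquiv_one] at h2
  simp only [SemidirectProduct.left_inl, toAdd_ofAdd] at h2
  have hdiff : ∀ α ∈ rootsJ P J, pair (Multiplicative.toAdd p.left - latticeEquiv z μ) α =
      negInd b (a • α) - negInd b (z⁻¹ • α) := by
    intro α hα
    have h3 := hmin (a • α) ((smul_mem_rootsJ b hJ ha α).2 hα)
    have h4 := hzμ (z⁻¹ • α) ((smul_mem_rootsJ b hJ (inv_mem hzJ) α).2 hα)
    rw [shift, h1, inv_smul_smul] at h3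
    rw [← pair_latticeEquiv z, smul_inv_smul] at h4
    rw [pair, map_sub, ← pair, ← pair]
    omega
  have hzero : Multiplicative.toAdd p.left - latticeEquiv z μ = 0 := by
    refine eq_zero_of_pair_le_one (Ψ := rootsJ P J)
      (fun α hα β hβ => refl_smul_mem_rootsJ hα hβ) ?_ fun α hα => ?_
    · have h3 : Multiplicative.toAdd p.left - latticeEquiv z μ = (μ - latticeEquiv z μ) - ν := by
        rw [h2]; abel
      have h4 : Submodule.span ℤ (P.coroot '' J) ≤ Submodule.span ℤ (P.coroot '' rootsJ P J) :=
        Submodule.span_mono (Set.image_mono fun j hj => mem_rootsJ_of_mem hj)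
      rw [h3]
      exact h4 (sub_mem (sub_latticeEquiv_mem hzJ μ) hν)
    · rw [hdiff α hα]
      have h3 := negInd_le_one b (a • α)
      have h4 := negInd_nonneg b (z⁻¹ • α)
      omega
  have haz : a * z = 1 := by
    refine eq_one_of_mem_parabolic b hJ (mul_mem ha hzJ) fun α hα => ?_
    have h3 := hdiff (z • α) ((smul_mem_rootsJ b hJ hzJ α).2 hα)
    rw [hzero, pair, map_zero, inv_smul_smul] at h3
    rw [mul_smul]
    omega
  apply aff_ext
  · rw [toAdd_left_fin_mul_transl]
    exact sub_eq_zero.1 hzero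
  · rw [right_fin_mul_transl, h1, inv_eq_of_mul_eq_one_right haz]

theorem liesOver_iff (hJ : J ⊆ b.support) (k : ℕ) (x : AffWeyl P) (w : P.weylGroup) :
    LiesOver b J k x w ↔ w ∈ minReps b J ∧ ∃ (μ : P.corootSpan ℤ) (z : P.weylGroup),
      IsSuperantidominant b J k μ ∧ IsProj b J (transl μ) (fin z * transl μ) ∧
        x = fin w * fin z * transl μ := by
  refine and_congr_right fun _ => exists_congr fun μ => ⟨?_, ?_⟩
  · rintro ⟨h1, ⟨z, hz⟩, p, hp, rfl⟩
    exact ⟨z, h1, hz, by rw [isProj_unique b hJ hz hp, mul_assoc]⟩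
  · rintro ⟨z, h1, hz, rfl⟩
    exact ⟨h1, ⟨z, hz⟩, _, hz, by rw [mul_assoc]⟩

/-- On `Φ_J` the shift is zero. At a positive root outside, depth at least one makes `⟨μ, α⟩ + [wzα
< 0]` nonpositive, so its absolute value is its negative. -/
theorem inversions_eq (hJ : J ⊆ b.support) {k : ℕ} (hk : 1 ≤ k) {w z : P.weylGroup}
    {μ : P.corootSpan ℤ} (hw : w ∈ minReps b J) (hμ : IsSuperantidominant b J k μ)
    (hz : IsProj b J (transl μ) (fin z * transl μ)) :
    (inversions b (fin w * fin z * transl μ) : ℤ) = - ∑ α ∈ offJ b J, pair μ α - len b w := by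
  classical
  obtain ⟨hzJ, hzμ⟩ := (isProj_iff b z μ).1 hz
  have hw' := (mem_minReps_iff b hJ).1 hw
  rw [inversions, Nat.cast_sum, sum_pos_eq b hJ fun α =>
    ((shift b (fin w * fin z * transl μ) α).natAbs : ℤ), len_eq_sum_offJ b hJ hw',
    ← sum_offJ_smul b hJ hzJ fun α => negInd b (w • α), ← Finset.sum_neg_distrib,
    ← Finset.sum_sub_distrib, ← add_zero (∑ α ∈ offJ b J, (-pair μ α - _))]
  refine congrArg₂ _ (Finset.sum_congr rfl fun α hα => ?_) (Finset.sum_eq_zero fun α hα => ?_)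
  · obtain ⟨hpos, hαJ⟩ := (mem_offJ b hJ).1 hα
    have h1 := hμ.2 α hpos hαJ
    have h2 := negInd_le_one b (w • z • α)
    rw [← fin_mul, shift_fin_mul_transl, negInd_of_pos b hpos, mul_smul]
    omega
  · have hα := (Finset.mem_filter.1 hα).2
    rw [← fin_mul, shift_fin_mul_transl, hzμ α hα.2, mul_smul,
      hw' _ ((smul_mem_rootsJ b hJ hzJ α).2 hα.2)]
    simp

/-- Depth is attained by multiples of the sum of the coroots of the positive roots outside `Φ_J`. -/
theorem exists_superantidominant (hJ : J ⊆ b.support) (k : ℕ) :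
    ∃ μ, IsSuperantidominant b J k μ ∧ IsAdjusted b J μ := by
  classical
  set η : P.corootSpan ℤ := ∑ β ∈ offJ b J, P.corootSpanMem ℤ β with hη
  have hpair : ∀ α, pair η α = ∑ β ∈ offJ b J, P.pairingIn ℤ α β := by
    intro α
    rw [hη, pair, map_sum]
    rfl
  have hsymm : ∀ α β, P.pairingIn ℤ α (refl P α • β) = - P.pairingIn ℤ α β := by
    intro α β
    have h := pairingIn_smul (refl P α) α (refl P α • β)
    rw [refl_smul_refl_smul, refl_smul (P := P) α α, P.pairingIn_reflectionPerm_self_left] at h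
    exact h.symm
  -- For `α ∈ Φ_J` the reflection `r_α` does not change `coordSum b J`, so there are no crossing
  -- roots.
  have hzero : ∀ α ∈ rootsJ P J, pair η α = 0 := by
    intro α hα
    rw [hpair, sum_offJ_eq_sum_crossing b (hsymm α)]
    refine Finset.sum_eq_zero fun β hβ => ?_
    obtain ⟨h1, h2⟩ := Finset.mem_filter.1 hβ
    refine absurd ?_ h2
    rw [mem_offJ_iff] at h1 ⊢
    rwa [coordSum_refl_smul, (mem_rootsJ_iff b hJ α).1 hα, mul_zero, sub_zero]
  have hpos : ∀ α, b.IsPos α → α ∉ rootsJ P J → 1 ≤ pair η α := by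
    intro α h1 h2
    have hα := (mem_offJ b hJ).2 ⟨h1, h2⟩
    have hp : ∀ β ∈ crossing b J α, 0 < P.pairingIn ℤ α β := fun β hβ =>
      (P.zero_lt_pairingIn_iff' ℤ).1 (one_le_pairingIn_of_mem_crossing b hα hβ)
    rw [hpair, sum_offJ_eq_sum_crossing b (hsymm α)]
    exact Finset.sum_pos hp ⟨α, self_mem_crossing b hα⟩
  have hk : ∀ α, pair (-(k : ℤ) • η) α = -(k : ℤ) * pair η α := by
    intro α
    rw [pair, map_zsmul, smul_eq_mul]
  refine ⟨-(k : ℤ) • η, ⟨fun α hα => ?_, fun α hα hαJ => ?_⟩, 1, ?_⟩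
  · rw [hk]
    by_cases hαJ : α ∈ rootsJ P J
    · rw [hzero α hαJ, mul_zero]
    · have := hpos α hα hαJ
      nlinarith
  · rw [hk]
    have := hpos α hα hαJ
    nlinarith
  · rw [isProj_iff]
    refine ⟨one_mem _, fun α hα => ?_⟩
    rw [hk, hzero α hα, one_smul, mul_zero, sub_self]

end Projection

/-! ### Edges of the quantum Bruhat graphs and covers in the affine Weyl group -/

section Lifting

variable [Fintype ι] [P.IsRootSystem] [P.IsCrystallographic] [P.IsReduced] (b : P.Base)
  {J : Finset ι}

/-- Both types of edge are put under one length equation. That equation only sees the minimal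
representative `v`, so for `χ = 0` it must be added that `w r_α` is itself minimal. -/
theorem isEdge_iff (hJ : J ⊆ b.support) (χ : ℤ) (w : P.weylGroup) (α : ι) (v : P.weylGroup) :
    IsEdge b J χ w α v ↔ (χ = 0 ∨ χ = 1) ∧ w ∈ minReps b J ∧ α ∈ offJ b J ∧
      v = floor b J (w * refl P α) ∧ (len b v : ℤ) = len b w + 1 - χ * rhoPairing b J α ∧
      (χ = 0 → w * refl P α ∈ minReps b J) := by
  have hfloor : w * refl P α ∈ minReps b J → floor b J (w * refl P α) = w * refl P α :=
    fun h => floor_eq b hJ h (by rw [inv_mul_cancel]; exact one_mem _)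
  constructor
  · rintro (⟨rfl, hw, h1, h2, hv, hcov⟩ | ⟨rfl, hw, h1, h2, hv, hlen⟩)
    · have hα := (mem_offJ b hJ).2 ⟨h1, h2⟩
      obtain ⟨-, -, hlen⟩ := (cover_iff b _ _).1 hcov
      have hmem := mul_refl_mem_minReps b hJ hw hα hlen
      refine ⟨Or.inl rfl, hw, hα, hv, ?_, fun _ => hmem⟩
      rw [hv, hfloor hmem, hlen]
      push_cast
      ring
    · exact ⟨Or.inr rfl, hw, (mem_offJ b hJ).2 ⟨h1, h2⟩, hv, by rw [one_mul]; exact hlen,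
        fun h => absurd h one_ne_zero⟩
  · rintro ⟨hχ, hw, hα, hv, hlen, hmem⟩
    obtain ⟨h1, h2⟩ := (mem_offJ b hJ).1 hα
    rcases hχ with rfl | rfl
    · refine Or.inl ⟨rfl, hw, h1, h2, hv, (cover_iff b _ _).2 ⟨α, rfl, ?_⟩⟩
      rw [hv, hfloor (hmem rfl)] at hlen
      omega
    · exact Or.inr ⟨rfl, hw, h1, h2, hv, by rwa [one_mul] at hlen⟩

theorem IsEdge.mul_pairingIn (hJ : J ⊆ b.support) {χ : ℤ} {w v : P.weylGroup} {α : ι}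
    (h : IsEdge b J χ w α v) {β : ι} (hβ : β ∈ rootsJ P J) :
    χ * P.pairingIn ℤ β α = negInd b β - negInd b ((w * refl P α) • β) := by
  obtain ⟨hχ, hw, hα, hv, hlen, hmem⟩ := (isEdge_iff b hJ _ _ _ _).1 h
  rcases hχ with rfl | rfl
  · rw [(mem_minReps_iff b hJ).1 (hmem rfl) β hβ, zero_mul, sub_self]
  · rw [one_mul]
    refine pairingIn_of_quantum b hJ hw hα ?_ hβ
    rw [← hv, hlen, one_mul]

theorem mul_affRefl (w z : P.weylGroup) (μ : P.corootSpan ℤ) (α : ι) (n : ℤ) :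
    fin w * fin z * transl μ * affRefl (z⁻¹ • α, n) = fin (w * refl P α * z) *
      transl (μ + (n - pair μ (z⁻¹ • α)) • P.corootSpanMem ℤ (z⁻¹ • α)) := by
  rw [mul_assoc, transl_mul_affRefl, ← mul_assoc, ← fin_mul, ← fin_mul, refl_conj, inv_inv]
  simp only [mul_assoc, mul_inv_cancel_left]

theorem pair_add_zsmul (μ : P.corootSpan ℤ) (χ : ℤ) (β δ : ι) :
    pair (μ + χ • P.corootSpanMem ℤ β) δ = pair μ δ + χ * P.pairingIn ℤ δ β := by
  rw [← pair_zsmul_coroot, pair, pair, pair, map_add]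

theorem sum_pair_add_zsmul (s : Finset ι) (μ : P.corootSpan ℤ) (χ : ℤ) (β : ι) :
    ∑ δ ∈ s, pair (μ + χ • P.corootSpanMem ℤ β) δ =
      ∑ δ ∈ s, pair μ δ + χ * ∑ δ ∈ s, P.pairingIn ℤ δ β := by
  rw [Finset.mul_sum, ← Finset.sum_add_distrib]
  exact Finset.sum_congr rfl fun δ _ => pair_add_zsmul μ χ β δ

/-- A bound for all pairings of roots with coroots. -/
def pairingBound (P : RootPairing ι ℝ M N) [P.IsCrystallographic] : ℕ :=
  ∑ γ : ι × ι, (P.pairingIn ℤ γ.1 γ.2).natAbs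

theorem pairingIn_le_pairingBound (α β : ι) : P.pairingIn ℤ α β ≤ pairingBound P := by
  have h : (P.pairingIn ℤ α β).natAbs ≤ pairingBound P :=
    Finset.single_le_sum (f := fun γ : ι × ι => (P.pairingIn ℤ γ.1 γ.2).natAbs)
      (fun _ _ => Nat.zero_le _) (Finset.mem_univ (α, β))
  omega

/-- Depth two is what makes `χ + ⟨μ, β⟩` negative even for `χ = 1`. -/
theorem affNeg_of_le (hJ : J ⊆ b.support) {k : ℕ} (hk : 2 ≤ k) {μ : P.corootSpan ℤ}
    (hμ : IsSuperantidominant b J k μ) {β : ι} (hβ : β ∈ offJ b J) {χ : ℤ} (hχ : χ = 0 ∨ χ = 1) :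
    AffNeg b (β, χ + pair μ β) := by
  obtain ⟨h1, h2⟩ := (mem_offJ b hJ).1 hβ
  have h3 := hμ.2 β h1 h2
  have h4 := negInd_nonneg b β
  rw [affNeg_iff, affPos_iff]
  simp only
  omega

theorem sum_pair_posJ {z : P.weylGroup} {μ : P.corootSpan ℤ} (hJ : J ⊆ b.support)
    (hz : IsProj b J (transl μ) (fin z * transl μ)) :
    (len b z : ℤ) = - ∑ δ ∈ posJ b J, pair μ δ := by
  classical
  obtain ⟨hzJ, hzμ⟩ := (isProj_iff b z μ).1 hz
  rw [len_eq_sum_posJ b hJ hzJ, ← Finset.sum_neg_distrib]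
  refine Finset.sum_congr rfl fun δ hδ => ?_
  have hδ := (Finset.mem_filter.1 hδ).2
  rw [hzμ δ hδ.2, negInd_of_pos b hδ.1]
  ring

/-- The projection of the translation at the lower end of the lift of an edge. -/
theorem isProj_of_isEdge (hJ : J ⊆ b.support) {χ : ℤ} {w v z : P.weylGroup} {α : ι}
    (h : IsEdge b J χ w α v) {μ : P.corootSpan ℤ}
    (hz : IsProj b J (transl μ) (fin z * transl μ)) :
    IsProj b J (transl (μ + χ • P.corootSpanMem ℤ (z⁻¹ • α)))
      (fin (v⁻¹ * (w * refl P α) * z) *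
        transl (μ + χ • P.corootSpanMem ℤ (z⁻¹ • α))) := by
  obtain ⟨hzJ, hzμ⟩ := (isProj_iff b z μ).1 hz
  obtain ⟨hχ, hw, hα, hv, hlen, -⟩ := (isEdge_iff b hJ _ _ _ _).1 h
  have hz' : v⁻¹ * (w * refl P α) * z ∈ parabolic P J := by
    rw [hv]
    exact mul_mem (floor_inv_mul_mem (J := J) b _) hzJ
  refine (isProj_iff b _ _).2 ⟨hz', fun δ hδ => ?_⟩
  have hzδ := (smul_mem_rootsJ b hJ hzJ δ).2 hδ
  -- The edge identity at `zδ` supplies the change in the pairing, and minimality of `v` identifies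
  -- the sign of `w r_α z δ` with that of `z' δ`, where `z' = v⁻¹ w r_α z`.
  have h1 := h.mul_pairingIn b hJ hzδ
  have h2 := pairingIn_smul z δ (z⁻¹ • α)
  rw [smul_inv_smul] at h2
  have h3 := (mem_minReps_iff b hJ).1 (hv ▸ floor_mem b _ : v ∈ minReps b J) _
    ((smul_mem_rootsJ b hJ hz' δ).2 hδ)
  rw [smul_smul, ← mul_assoc, mul_inv_cancel_left, mul_smul] at h3
  rw [pair_add_zsmul, hzμ δ hδ, ← h2, h1, ← h3]
  ring

/-- Outside `Φ_J` the extra depth `pairingBound P` absorbs the added coroot. On `Φ_J⁺` depth says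
nothing, and antidominance comes from being `J`-adjusted. -/
theorem isSuperantidominant_add {χ : ℤ} (hχ : χ = 0 ∨ χ = 1)
    {z' : P.weylGroup} {β : ι} {μ : P.corootSpan ℤ} {k : ℕ}
    (hμ : IsSuperantidominant b J (k + pairingBound P) μ)
    (hz' : IsProj b J (transl (μ + χ • P.corootSpanMem ℤ β))
      (fin z' * transl (μ + χ • P.corootSpanMem ℤ β))) :
    IsSuperantidominant b J k (μ + χ • P.corootSpanMem ℤ β) := by
  have key : ∀ δ, b.IsPos δ → δ ∉ rootsJ P J →
      pair (μ + χ • P.corootSpanMem ℤ β) δ ≤ -(k : ℤ) := by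
    intro δ h1 h2
    have h3 := hμ.2 δ h1 h2
    have h4 := pairingIn_le_pairingBound (P := P) δ β
    push_cast at h3
    rw [pair_add_zsmul]
    rcases hχ with rfl | rfl
    · rw [zero_mul]; omega
    · rw [one_mul]; omega
  refine ⟨fun δ h1 => ?_, key⟩
  by_cases h2 : δ ∈ rootsJ P J
  · rw [((isProj_iff b z' _).1 hz').2 δ h2, negInd_of_pos b h1]
    have := negInd_nonneg b (z' • δ)
    omega
  · have := key δ h1 h2
    omega

/-- The difference of the numbers of inversions of two elements of `Ω_J` which differ by a
reflection. -/
theorem inversions_sub (hJ : J ⊆ b.support) {k : ℕ} (hk : 1 ≤ k) {χ : ℤ}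
    {w v z z' : P.weylGroup} {α : ι} {μ : P.corootSpan ℤ} (hw : w ∈ minReps b J)
    (hv : v ∈ minReps b J) (hμ : IsSuperantidominant b J k μ)
    (hμ' : IsSuperantidominant b J k (μ + χ • P.corootSpanMem ℤ (z⁻¹ • α)))
    (hz : IsProj b J (transl μ) (fin z * transl μ))
    (hz' : IsProj b J (transl (μ + χ • P.corootSpanMem ℤ (z⁻¹ • α)))
      (fin z' * transl (μ + χ • P.corootSpanMem ℤ (z⁻¹ • α)))) :
    (inversions b (fin w * fin z * transl μ) : ℤ) -
      inversions b (fin v * fin z' * transl (μ + χ • P.corootSpanMem ℤ (z⁻¹ • α))) =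
      len b v - len b w + χ * rhoPairing b J α := by
  rw [inversions_eq b hJ hk hw hμ hz, inversions_eq b hJ hk hv hμ' hz', sum_pair_add_zsmul,
    ← rhoPairing_eq_sum b hJ, rhoPairing_smul b hJ (inv_mem ((isProj_iff b z μ).1 hz).1)]
  ring

/-! ### The two directions of the correspondence. -/

variable [P.IsIrreducible]

theorem exists_cover_of_isEdge (hJ : J ⊆ b.support) {k : ℕ} (hk : 2 ≤ k) {χ : ℤ}
    {w v z : P.weylGroup} {α : ι} (h : IsEdge b J χ w α v) {μ : P.corootSpan ℤ}
    (hμ : IsSuperantidominant b J (k + pairingBound P) μ)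
    (hz : IsProj b J (transl μ) (fin z * transl μ)) :
    ∃ (x y : AffWeyl P) (γ : AffRoot P),
      OmegaCover b J k y x ∧ LiesOver b J k x w ∧ LiesOver b J k y v ∧
      x = fin w * fin z * transl μ ∧
      γ = (z⁻¹ • α, χ + pair μ (z⁻¹ • α)) ∧ AffNeg b γ ∧
      y = x * affRefl γ ∧
      y = fin w * fin (refl P α) * transl (χ • P.corootSpanMem ℤ α) *
        fin z * transl μ := by
  obtain ⟨hχ, hw, hα, hv, hlen, -⟩ := (isEdge_iff b hJ _ _ _ _).1 h
  have hzJ := ((isProj_iff b z μ).1 hz).1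
  have hvmin : v ∈ minReps b J := hv ▸ floor_mem b _
  have hβ : z⁻¹ • α ∈ offJ b J := (smul_mem_offJ b hJ (inv_mem hzJ)).2 hα
  have hμk : IsSuperantidominant b J k μ := ⟨hμ.1, fun δ h1 h2 => by
    have := hμ.2 δ h1 h2
    push_cast at this
    omega⟩
  have hz' := isProj_of_isEdge b hJ h hz
  have hμ' := isSuperantidominant_add b hχ hμ hz'
  have hyx := mul_affRefl w z μ α (χ + pair μ (z⁻¹ • α))
  rw [add_sub_cancel_right] at hyx
  have hy : fin w * fin z * transl μ * affRefl (z⁻¹ • α, χ + pair μ (z⁻¹ • α)) =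
      fin v * fin (v⁻¹ * (w * refl P α) * z) *
        transl (μ + χ • P.corootSpanMem ℤ (z⁻¹ • α)) := by
    rw [hyx, ← fin_mul]
    congr 2
    group
  have hxw : LiesOver b J k (fin w * fin z * transl μ) w :=
    (liesOver_iff b hJ k _ w).2 ⟨hw, μ, z, hμk, hz, rfl⟩
  have hyv : LiesOver b J k
      (fin w * fin z * transl μ * affRefl (z⁻¹ • α, χ + pair μ (z⁻¹ • α))) v :=
    (liesOver_iff b hJ k _ v).2 ⟨hvmin, _, _, hμ', hz', hy⟩
  refine ⟨_, _, _, ⟨⟨v, hyv⟩, ⟨w, hxw⟩, ?_, _, ((mem_offJ b hJ).1 hβ).2, rfl⟩, hxw, hyv, rfl, rfl,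
    affNeg_of_le b hJ hk hμk hβ hχ, rfl, ?_⟩
  · refine (affCover_iff b _ _).2 ⟨(z⁻¹ • α, χ + pair μ (z⁻¹ • α)), ?_, ?_⟩
    · rw [mul_assoc _ (affRefl _), affRefl_mul_self, mul_one]
    · have hsub := inversions_sub b hJ (k := k) (by omega) hw hvmin hμk hμ' hz hz'
      rw [← hy, hlen] at hsub
      omega
  · rw [hyx, fin_mul, fin_mul, mul_assoc _ (transl _) (fin z), transl_mul_fin, map_zsmul,
      latticeEquiv_coroot]
    simp only [mul_assoc]
    rw [transl_mul_transl, add_comm]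

theorem eq_of_forall_negInd (hJ : J ⊆ b.support) {z z' : P.weylGroup} (hz : z ∈ parabolic P J)
    (hz' : z' ∈ parabolic P J)
    (h : ∀ δ ∈ rootsJ P J, negInd b (z • δ) = negInd b (z' • δ)) : z = z' := by
  refine mul_inv_eq_one.1 (eq_one_of_mem_parabolic b hJ (mul_mem hz (inv_mem hz')) fun δ hδ => ?_)
  rw [mul_smul, h _ ((smul_mem_rootsJ b hJ (inv_mem hz') δ).2 hδ), smul_inv_smul]

theorem isEdge_of_cover (hJ : J ⊆ b.support) {k : ℕ} (hk : 2 ≤ k) {x y : AffWeyl P}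
    (h : OmegaCover b J k y x) :
    ∃ w ∈ minReps b J, ∃ z ∈ parabolic P J, ∃ (μ : P.corootSpan ℤ) (α : ι) (n χ : ℤ)
      (γ : AffRoot P),
      IsSuperantidominant b J k μ ∧ IsProj b J (transl μ) (fin z * transl μ) ∧
      x = fin w * fin z * transl μ ∧
      b.IsPos α ∧ α ∉ rootsJ P J ∧
      γ = (z⁻¹ • α, n) ∧ y = x * affRefl γ ∧
      χ = n - pair μ (z⁻¹ • α) ∧ (χ = 0 ∨ χ = 1) ∧
      γ = (z⁻¹ • α, χ + pair μ (z⁻¹ • α)) ∧ AffNeg b γ ∧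
      LiesOver b J k x w ∧ LiesOver b J k y (floor b J (w * refl P α)) ∧
      IsEdge b ∅ χ (w * z) (z⁻¹ • α) (w * refl P α * z) ∧
      IsEdge b J χ w α (floor b J (w * refl P α)) := by
  obtain ⟨⟨v, hyv⟩, ⟨w, hxw⟩, hcov, γ, hγ, hyγ⟩ := h
  obtain ⟨hw, μ, z, hμ, hz, hx⟩ := (liesOver_iff b hJ k x w).1 hxw
  obtain ⟨hv, μ', z', hμ', hz', hy⟩ := (liesOver_iff b hJ k y v).1 hyv
  obtain ⟨hzJ, hzμ⟩ := (isProj_iff b z μ).1 hz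
  obtain ⟨hzJ', hzμ'⟩ := (isProj_iff b z' μ').1 hz'
  -- The roots `γ` and `-γ` have the same reflection, so the classical part may be taken positive.
  obtain ⟨β, n, hβ, hyn⟩ : ∃ β n, β ∈ offJ b J ∧ y = x * affRefl (β, n) := by
    by_cases hpos : b.IsPos γ.1
    · exact ⟨γ.1, γ.2, (mem_offJ b hJ).2 ⟨hpos, hγ⟩, hyγ⟩
    · refine ⟨P.reflectionPerm γ.1 γ.1, -γ.2, (mem_offJ b hJ).2 ⟨(isPos_neg_iff b _).2 hpos,
        fun h' => hγ ((neg_mem_rootsJ _).1 h')⟩, ?_⟩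
      rw [affRefl_neg]
      exact hyγ
  obtain ⟨α, rfl⟩ : ∃ α, β = z⁻¹ • α := ⟨z • β, (inv_smul_smul z β).symm⟩
  have hα : α ∈ offJ b J := (smul_mem_offJ b hJ (inv_mem hzJ)).1 hβ
  obtain ⟨hαpos, hαJ⟩ := (mem_offJ b hJ).1 hα
  have hyx := mul_affRefl w z μ α n
  rw [← hx, ← hyn, hy, ← fin_mul] at hyx
  obtain ⟨χ, hχn⟩ : ∃ χ, χ = n - pair μ (z⁻¹ • α) := ⟨_, rfl⟩
  rw [← hχn] at hyx
  obtain ⟨hvz, rfl⟩ := fin_mul_transl_inj hyx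
  have hfloor : floor b J (w * refl P α) = v := by
    refine floor_eq b hJ hv ?_
    have : (w * refl P α)⁻¹ * v = z * z'⁻¹ := by
      rw [eq_mul_inv_of_mul_eq hvz]
      group
    rw [this]
    exact mul_mem hzJ (inv_mem hzJ')
  have hinv : (inversions b x : ℤ) - inversions b y = 1 := by
    obtain ⟨-, -, h1⟩ := (affCover_iff b _ _).1 hcov
    rw [h1]
    push_cast
    ring
  rw [hx, hy, inversions_sub b hJ (by omega) hw hv hμ hμ' hz hz'] at hinv
  -- With `R = ⟨α^∨, 2ρ - 2ρ_J⟩`, the cover condition reads `χR = 1 + ℓ(w) - ℓ(v)`, and `|ℓ(w) -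
  -- ℓ(v)| < R` leaves only two values of `χ`.
  have hχ : χ = 0 ∨ χ = 1 := by
    have h1 := abs_lt.1 (abs_len_sub_len_floor_lt b hJ hw hα)
    rw [hfloor] at h1
    have h2 := two_le_rhoPairing b hJ hα
    have h3 : χ ≤ 1 := by
      by_contra! hc
      nlinarith
    have h4 : 0 ≤ χ := by
      by_contra! hc
      nlinarith
    omega
  -- For `χ = 0` the translation part is unchanged, so `z = z'` and `v = w r_α`.
  have hzero : χ = 0 → w * refl P α ∈ minReps b J := by
    rintro rfl
    have hzz : z = z' := by
      refine eq_of_forall_negInd b hJ hzJ hzJ' fun δ hδ => ?_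
      have h1 := hzμ δ hδ
      have h2 := hzμ' δ hδ
      rw [pair_add_zsmul] at h2
      omega
    rw [hzz] at hvz
    rwa [← mul_right_cancel hvz]
  have hγ' : n = χ + pair μ (z⁻¹ • α) := by omega
  refine ⟨w, hw, z, hzJ, μ, α, n, χ, (z⁻¹ • α, n), hμ, hz, hx, hαpos, hαJ, rfl, hyn, hχn, hχ,
    by rw [hγ'], ?_, hxw, by rwa [hfloor], ?_, ?_⟩
  · rw [hγ']
    exact affNeg_of_le b hJ hk hμ hβ hχ
  · have hmul : w * z * refl P (z⁻¹ • α) = w * refl P α * z := by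
      rw [refl_conj, inv_inv]
      group
    refine (isEdge_iff b (Finset.empty_subset _) _ _ _ _).2 ⟨hχ, mem_minReps_empty b _,
      (mem_offJ b (Finset.empty_subset _)).2 ⟨((mem_offJ b hJ).1 hβ).1, notMem_rootsJ_empty _⟩,
      by rw [hmul, floor_empty], ?_, fun _ => mem_minReps_empty b _⟩
    -- The change from `ℓ(z)` to `ℓ(z')` accounts exactly for the `Φ_J⁺` part of `2ρ`, which turns
    -- the length condition for `2ρ - 2ρ_J` into the one for `2ρ`.
    have h1 := sum_pair_posJ b hJ hz
    have h2 := sum_pair_posJ b hJ hz'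
    rw [sum_pair_add_zsmul] at h2
    rw [← hvz, len_mul b hJ ((mem_minReps_iff b hJ).1 hv) hzJ',
      len_mul b hJ ((mem_minReps_iff b hJ).1 hw) hzJ, rhoPairing_empty b hJ,
      rhoPairing_smul b hJ (inv_mem hzJ)]
    push_cast
    linarith
  · refine (isEdge_iff b hJ _ _ _ _).2 ⟨hχ, hw, hα, rfl, ?_, hzero⟩
    rw [hfloor]
    linarith

end Lifting

end QBLift

end

open QBLift in
theorem propositionP {ι M N : Type*} [Fintype ι] [AddCommGroup M] [Module ℝ M]
    [AddCommGroup N] [Module ℝ N] (P : RootPairing ι ℝ M N) [P.IsRootSystem]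
    [P.IsCrystallographic] [P.IsReduced] [P.IsIrreducible] (b : P.Base) :
    ∃ k₀ c : ℕ, ∀ J ⊆ b.support,
      (∀ k, ∃ μ, IsSuperantidominant b J k μ ∧ IsAdjusted b J μ) ∧
      ∀ k ≥ k₀,
        (∀ (χ : ℤ) (w : P.weylGroup) (α : ι) (v : P.weylGroup), IsEdge b J χ w α v →
          ∀ (μ : P.corootSpan ℤ) (z : P.weylGroup), IsSuperantidominant b J (k + c) μ →
            IsProj b J (transl μ) (fin z * transl μ) →
            ∃ (x y : AffWeyl P) (γ : AffRoot P),
              OmegaCover b J k y x ∧ LiesOver b J k x w ∧ LiesOver b J k y v ∧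
              x = fin w * fin z * transl μ ∧
              γ = (z⁻¹ • α, χ + pair μ (z⁻¹ • α)) ∧ AffNeg b γ ∧
              y = x * affRefl γ ∧
              y = fin w * fin (refl P α) * transl (χ • P.corootSpanMem ℤ α) *
                fin z * transl μ) ∧
        (∀ x y : AffWeyl P, OmegaCover b J k y x →
          ∃ w ∈ minReps b J, ∃ z ∈ parabolic P J, ∃ (μ : P.corootSpan ℤ) (α : ι) (n χ : ℤ)
            (γ : AffRoot P),
            IsSuperantidominant b J k μ ∧ IsProj b J (transl μ) (fin z * transl μ) ∧
            x = fin w * fin z * transl μ ∧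
            b.IsPos α ∧ α ∉ rootsJ P J ∧
            γ = (z⁻¹ • α, n) ∧ y = x * affRefl γ ∧
            χ = n - pair μ (z⁻¹ • α) ∧ (χ = 0 ∨ χ = 1) ∧
            γ = (z⁻¹ • α, χ + pair μ (z⁻¹ • α)) ∧ AffNeg b γ ∧
            LiesOver b J k x w ∧ LiesOver b J k y (floor b J (w * refl P α)) ∧
            IsEdge b ∅ χ (w * z) (z⁻¹ • α) (w * refl P α * z) ∧
            IsEdge b J χ w α (floor b J (w * refl P α))) := by
  -- Depth two ensures negativity of the connecting root, and `pairingBound P` is the depth that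
  -- adding one coroot can cost.
  refine ⟨2, pairingBound P, fun J hJ => ⟨exists_superantidominant b hJ, fun k hk => ⟨?_, ?_⟩⟩⟩
  · intro χ w α v h μ z hμ hz
    exact exists_cover_of_isEdge b hJ hk h hμ hz
  · intro x y h
    exact isEdge_of_cover b hJ hk h
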